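/- An instance of the market share ranking problem consists of $n\ge 1$ products with preference weights $w_1,\dots,w_n\ge 0$, of $K\ge 1$ customers with proportions $\theta_1,\dots,\theta_K\ge 0$, $\sum_{k}\theta_k=1$, and, for each customer $k$, of real reservation prices $r^k_1\ge\dots\ge r^k_n$. For a bijection (assignment) $\mathcal A:[n]\to[n]$ from positions to products and a set $S$ of products, let $w(S)=\sum_{i\in S}w_i$ and let $\mathcal A[1,p]=\{\mathcal A(1),\dots,\mathcal A(p)\}$. The stopping point $s_k^{\mathcal A}$ of customer $k$ is the least $p\in[n]$ with $w(\mathcal A[1,p])\ge r^k_p$, or $n$ if there is none; her consideration set is $C_k^{\mathcal A}=\mathcal A[1,s_k^{\mathcal A}]$. The expected market share of $\mathcal A$ is $$M(\mathcal A)=\sum_{k=1}^K\theta_k\,\frac{w(C_k^{\mathcal A})}{1+w(C_k^{\mathcal A})},$$ and $\mathrm{OPT}=\max_{\mathcal A}M(\mathcal A)$. Theorem. There is an algorithm that, given any $0<\epsilon<1$ and any such instance, computes an assignment $\mathcal A$ with $M(\mathcal A)\ge(1-\epsilon)\cdot\mathrm{OPT}$ in time $O\big(K^2\,n^{O(\frac1\epsilon\log\frac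 n\epsilon)}\big)$, where the constants hidden in both $O(\cdot)$ are absolute. Running time is measured on a real random access machine: arithmetic operations ($+,-,\times,/$) and comparisons on real numbers, addition, truncated subtraction and comparison of natural numbers, conversion of a natural number to a real, and memory accesses at natural-number addresses each take unit time. -/

import Mathlib

/-! ### The market share ranking problem -/

/-- An instance with `n` products and `K` customer segments: MNL preference weights `w`, segment
proportions `θ`, and for every customer a weakly decreasing sequence of reservation prices `r k`.
Products, positions and customers are numbered from `0`. -/
structure RankingInstance (n K : ℕ) where
  w : Fin n → ℝ
  θ : Fin K → ℝ
  r : Fin K → Fin n → ℝ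
  w_nonneg : ∀ i, 0 ≤ w i
  θ_nonneg : ∀ k, 0 ≤ θ k
  θ_sum : ∑ k, θ k = 1
  r_antitone : ∀ k, Antitone (r k)

namespace RankingInstance

variable {n K : ℕ} (I : RankingInstance n K)

/-- The total weight of a set of products. -/
def weight (S : Finset (Fin n)) : ℝ := ∑ i ∈ S, I.w i

/-- The set of products placed by the assignment `A` in its first `m` positions. -/
def firstProducts (A : Equiv.Perm (Fin n)) (m : ℕ) : Finset (Fin n) :=
  (Finset.univ.filter fun p : Fin n => (p : ℕ) < m).image A

/-- The number of positions inspected by customer `k`: the least `m` for which the total weight of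
the first `m` products is at least the reservation price of the `m`-th position, and `n` if there
is no such `m`. -/
noncomputable def stoppingPoint (A : Equiv.Perm (Fin n)) (k : Fin K) : ℕ :=
  sInf ({m | ∃ p : Fin n, m = (p : ℕ) + 1 ∧ I.r k p ≤ I.weight (firstProducts A m)} ∪ {n})

/-- The consideration set of customer `k`. -/
noncomputable def considerationSet (A : Equiv.Perm (Fin n)) (k : Fin K) : Finset (Fin n) :=
  firstProducts A (I.stoppingPoint A k)

/-- The probability that customer `k` purchases some product, under the MNL model. -/
noncomputable def customerShare (A : Equiv.Perm (Fin n)) (k : Fin K) : ℝ :=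
  I.weight (I.considerationSet A k) / (1 + I.weight (I.considerationSet A k))

/-- The expected market share of the assignment `A`. -/
noncomputable def marketShare (A : Equiv.Perm (Fin n)) : ℝ :=
  ∑ k, I.θ k * I.customerShare A k

/-- The maximum expected market share over all assignments. -/
noncomputable def opt : ℝ :=
  Finset.univ.sup' Finset.univ_nonempty I.marketShare

end RankingInstance

/-! ### The machine model: structured programs for a real random access machine

The memory consists of arrays of natural numbers and arrays of real numbers, every array being
infinite and named by a natural number that is fixed in the program text. Array entries can be
addressed by computed natural numbers. The available operations are addition and truncated
subtraction of natural numbers, the four field operations on reals, conversion of a natural number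
to a real, and comparisons; there is no rounding, and the only constants are natural numbers. Each
constant, memory access, arithmetic or logical operation, comparison, assignment and test costs one
time unit. (Division by zero returns zero, which a program could also achieve by a test.) -/

namespace RealRAM

/-- Memory contents: `nat a i` and `real a i` are the entries with index `i` of the arrays named
`a`. -/
structure Memory where
  nat : ℕ → ℕ → ℕ
  real : ℕ → ℕ → ℝ

/-- Assign the value `v` to entry `i` of the natural number array `a`. -/
def Memory.setNat (s : Memory) (a i v : ℕ) : Memory :=
  { s with nat := Function.update s.nat a (Function.update (s.nat a) i v) }

/-- Assign the value `v` to entry `i` of the real array `a`. -/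
noncomputable def Memory.setReal (s : Memory) (a i : ℕ) (v : ℝ) : Memory :=
  { s with real := Function.update s.real a (Function.update (s.real a) i v) }

/-- Natural number expressions. -/
inductive NatExpr where
  | const (c : ℕ)
  | get (a : ℕ) (i : NatExpr)
  | add (x y : NatExpr)
  | sub (x y : NatExpr)

def NatExpr.eval (s : Memory) : NatExpr → ℕ
  | const c => c
  | get a i => s.nat a (i.eval s)
  | add x y => x.eval s + y.eval s
  | sub x y => x.eval s - y.eval s

def NatExpr.cost : NatExpr → ℕ
  | const _ => 1
  | get _ i => i.cost + 1
  | add x y => x.cost + y.cost + 1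
  | sub x y => x.cost + y.cost + 1

/-- Real expressions. -/
inductive RealExpr where
  | ofNat (x : NatExpr)
  | get (a : ℕ) (i : NatExpr)
  | add (x y : RealExpr)
  | sub (x y : RealExpr)
  | mul (x y : RealExpr)
  | div (x y : RealExpr)

noncomputable def RealExpr.eval (s : Memory) : RealExpr → ℝ
  | ofNat x => (x.eval s : ℝ)
  | get a i => s.real a (i.eval s)
  | add x y => x.eval s + y.eval s
  | sub x y => x.eval s - y.eval s
  | mul x y => x.eval s * y.eval s
  | div x y => x.eval s / y.eval s

def RealExpr.cost : RealExpr → ℕ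
  | ofNat x => x.cost + 1
  | get _ i => i.cost + 1
  | add x y => x.cost + y.cost + 1
  | sub x y => x.cost + y.cost + 1
  | mul x y => x.cost + y.cost + 1
  | div x y => x.cost + y.cost + 1

/-- Tests. -/
inductive Test where
  | natLE (x y : NatExpr)
  | realLE (x y : RealExpr)
  | not (b : Test)
  | and (b c : Test)

def Test.Holds (s : Memory) : Test → Prop
  | natLE x y => x.eval s ≤ y.eval s
  | realLE x y => x.eval s ≤ y.eval s
  | not b => ¬ b.Holds s
  | and b c => b.Holds s ∧ c.Holds s

def Test.cost : Test → ℕ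
  | natLE x y => x.cost + y.cost + 1
  | realLE x y => x.cost + y.cost + 1
  | not b => b.cost + 1
  | and b c => b.cost + c.cost + 1

/-- Programs. -/
inductive Program where
  | skip
  | assignNat (a : ℕ) (i x : NatExpr)
  | assignReal (a : ℕ) (i : NatExpr) (x : RealExpr)
  | seq (P Q : Program)
  | cond (b : Test) (P Q : Program)
  | loop (b : Test) (P : Program)

/-- `Runs P s s' t`: started with memory `s`, the program `P` halts with memory `s'` after exactly
`t` time units. Here `loop b P` repeats `P` as long as the test `b` holds. -/
inductive Runs : Program → Memory → Memory → ℕ → Prop where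
  | skip (s : Memory) : Runs .skip s s 1
  | assignNat (a : ℕ) (i x : NatExpr) (s : Memory) :
      Runs (.assignNat a i x) s (s.setNat a (i.eval s) (x.eval s)) (i.cost + x.cost + 1)
  | assignReal (a : ℕ) (i : NatExpr) (x : RealExpr) (s : Memory) :
      Runs (.assignReal a i x) s (s.setReal a (i.eval s) (x.eval s)) (i.cost + x.cost + 1)
  | seq {P Q : Program} {s₁ s₂ s₃ : Memory} {t u : ℕ}
      (hP : Runs P s₁ s₂ t) (hQ : Runs Q s₂ s₃ u) : Runs (.seq P Q) s₁ s₃ (t + u)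
  | cond_true {b : Test} {P : Program} (Q : Program) {s s' : Memory} {t : ℕ}
      (hb : b.Holds s) (hP : Runs P s s' t) : Runs (.cond b P Q) s s' (b.cost + 1 + t)
  | cond_false {b : Test} (P : Program) {Q : Program} {s s' : Memory} {t : ℕ}
      (hb : ¬ b.Holds s) (hQ : Runs Q s s' t) : Runs (.cond b P Q) s s' (b.cost + 1 + t)
  | loop_done {b : Test} (P : Program) {s : Memory}
      (hb : ¬ b.Holds s) : Runs (.loop b P) s s (b.cost + 1)
  | loop_step {b : Test} {P : Program} {s₁ s₂ s₃ : Memory} {t u : ℕ}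
      (hb : b.Holds s₁) (hP : Runs P s₁ s₂ t) (hL : Runs (.loop b P) s₂ s₃ u) :
      Runs (.loop b P) s₁ s₃ (b.cost + 1 + t + u)

/-- Programs are deterministic: the final memory and the running time are determined by the
initial memory. -/
theorem Runs.deterministic {P : Program} {s s₁ s₂ : Memory} {t₁ t₂ : ℕ}
    (h₁ : Runs P s s₁ t₁) (h₂ : Runs P s s₂ t₂) : s₁ = s₂ ∧ t₁ = t₂ := by
  induction h₁ generalizing s₂ t₂ with
  | skip => cases h₂; exact ⟨rfl, rfl⟩
  | assignNat => cases h₂; exact ⟨rfl, rfl⟩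
  | assignReal => cases h₂; exact ⟨rfl, rfl⟩
  | seq _ _ ihP ihQ =>
    cases h₂ with
    | seq hP hQ =>
      obtain ⟨rfl, rfl⟩ := ihP hP
      obtain ⟨rfl, rfl⟩ := ihQ hQ
      exact ⟨rfl, rfl⟩
  | cond_true _ hb _ ih =>
    cases h₂ with
    | cond_true _ _ h => obtain ⟨rfl, rfl⟩ := ih h; exact ⟨rfl, rfl⟩
    | cond_false _ hb' _ => exact absurd hb hb'
  | cond_false _ hb _ ih =>
    cases h₂ with
    | cond_true _ hb' _ => exact absurd hb' hb
    | cond_false _ _ h => obtain ⟨rfl, rfl⟩ := ih h; exact ⟨rfl, rfl⟩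
  | loop_done _ hb =>
    cases h₂ with
    | loop_done _ _ => exact ⟨rfl, rfl⟩
    | loop_step hb' _ _ => exact absurd hb' hb
  | loop_step hb _ _ ihP ihL =>
    cases h₂ with
    | loop_done _ hb' => exact absurd hb hb'
    | loop_step _ hP hL =>
      obtain ⟨rfl, rfl⟩ := ihP hP
      obtain ⟨rfl, rfl⟩ := ihL hL
      exact ⟨rfl, rfl⟩

end RealRAM

/-- The initial memory for the accuracy `ε` and the instance `I`. The numbers `n` and `K` are the
entries `0` and `1` of natural number array `0`; real array `0` holds `ε` in entry `0`; the real
arrays `1`, `2` and `3` hold the weights, the proportions, and the reservation prices in row-major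
order (entry `k * n + p` is the price of customer `k` at position `p`). All else is zero. -/
noncomputable def RankingInstance.input {n K : ℕ} (I : RankingInstance n K) (ε : ℝ) :
    RealRAM.Memory where
  nat a i := if a = 0 ∧ i = 0 then n else if a = 0 ∧ i = 1 then K else 0
  real a j :=
    if a = 0 ∧ j = 0 then ε
    else if a = 1 then (if h : j < n then I.w ⟨j, h⟩ else 0)
    else if a = 2 then (if h : j < K then I.θ ⟨j, h⟩ else 0)
    else if a = 3 then
      (if h : j < K * n then
        I.r (finProdFinEquiv.symm ⟨j, h⟩).1 (finProdFinEquiv.symm ⟨j, h⟩).2 else 0)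
    else 0

/-- The final memory `s` holds the assignment `A`: entry `p` of natural number array `1` is the
product placed at position `p`. -/
def RealRAM.Memory.Outputs {n : ℕ} (s : RealRAM.Memory) (A : Equiv.Perm (Fin n)) : Prop :=
  ∀ p : Fin n, s.nat 1 p = (A p : ℕ)

/-!
An approximation scheme for the market share ranking problem.

Write `share x = x / (1 + x)`. The market share of an assignment depends only on the cumulative
weights `W 0 ≤ W 1 ≤ … ≤ W n`. Since the reservation prices decrease, a customer has stopped before
position `p` exactly if her stopping condition holds at `p` itself, so the market share telescopes
(`RankingInstance.shareOf_eq_sum`): the step from `p` to `p + 1` contributes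
`share (W (p + 1)) - share (W p)`, multiplied with the proportion of the customers for whom the
condition fails at `p`. The contribution of a step depends only on `p` and on the set of products
used before and after the step. This suits a dynamic program, provided that there are few sets.

For this, the products are classified by the share `share w` of their weight: one class for the
light products, with share at most `τ = ε * gm / (4 * n)`, where `gm` is the largest share of a
product, and one class for every further factor `ρ = 1 + ε / 2`. This gives
`O ((1 / ε) * log (n / ε))` classes. Only assignments are considered in which the products of each
class appear in increasing order of weight. A state is then a vector of numbers of used products per
class, and there are at most `(n + 1) ^ L` of them for `L` classes.

Little is lost by this restriction. Given any assignment, rearrange the products inside their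
classes, keeping the sequence of classes. All cumulative weights become smaller
(`RealRAM.Tables.Valid.weight_follow_le`), so that all customers stop later, and cumulative weights
only increase afterwards. On the other hand, at a fixed position the share decreases at most by the
factor `ρ` and by the total weight of the light products (`RealRAM.Tables.Valid.share_le_follow`):
the map which divides the share of a weight by `ρ` is concave, hence subadditive, so a factor `ρ`
for the single products is a factor `ρ` for their sum. The light products contribute at most
`ε / 2 * gm`, and `gm` is at most the optimum, since placing the product in question first
guarantees this share from every customer. Together,
`opt ≤ (1 + ε / 2) * value + ε / 2 * opt`, where `value` is the result of the dynamic program.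

The program codes a state by the number whose digits in base `n + 1` are the numbers of used
products. It tabulates quotients and remainders modulo the base, processes the states in decreasing
order of their codes, and finally follows the optimal choices from the empty state. Its analysis
uses a Hoare logic for total correctness with time bounds (`RealRAM.Achieves`), with a frame rule
(`RealRAM.Runs.agree`) and a rule for counting loops (`RealRAM.Achieves.forLoop`).
-/

/-! ### Program logic -/

namespace RealRAM

@[simp] theorem Memory.setNat_nat (s : Memory) (a i v : ℕ) :
    (s.setNat a i v).nat = Function.update s.nat a (Function.update (s.nat a) i v) := rfl

@[simp] theorem Memory.setNat_real (s : Memory) (a i v : ℕ) : (s.setNat a i v).real = s.real := rfl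

@[simp] theorem Memory.setReal_nat (s : Memory) (a i : ℕ) (v : ℝ) :
    (s.setReal a i v).nat = s.nat := rfl

@[simp] theorem Memory.setReal_real (s : Memory) (a i : ℕ) (v : ℝ) :
    (s.setReal a i v).real = Function.update s.real a (Function.update (s.real a) i v) := rfl

/-- The natural number arrays to which a program assigns. -/
def Program.writesNat : Program → List ℕ
  | skip => []
  | assignNat a _ _ => [a]
  | assignReal _ _ _ => []
  | seq P Q => P.writesNat ++ Q.writesNat
  | cond _ P Q => P.writesNat ++ Q.writesNat
  | loop _ P => P.writesNat

/-- The real arrays to which a program assigns. -/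
def Program.writesReal : Program → List ℕ
  | skip => []
  | assignNat _ _ _ => []
  | assignReal a _ _ => [a]
  | seq P Q => P.writesReal ++ Q.writesReal
  | cond _ P Q => P.writesReal ++ Q.writesReal
  | loop _ P => P.writesReal

/-- The memories `s` and `s'` agree outside of the natural number arrays in `l` and the real arrays
in `m`. -/
def Agree (l m : List ℕ) (s s' : Memory) : Prop :=
  (∀ a, a ∉ l → s'.nat a = s.nat a) ∧ ∀ a, a ∉ m → s'.real a = s.real a

theorem Agree.refl (l m : List ℕ) (s : Memory) : Agree l m s s := ⟨fun _ _ => rfl, fun _ _ => rfl⟩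

theorem Agree.trans {l m : List ℕ} {s₁ s₂ s₃ : Memory} (h : Agree l m s₁ s₂)
    (h' : Agree l m s₂ s₃) : Agree l m s₁ s₃ :=
  ⟨fun a ha => (h'.1 a ha).trans (h.1 a ha), fun a ha => (h'.2 a ha).trans (h.2 a ha)⟩

theorem Agree.mono {l m l' m' : List ℕ} {s s' : Memory} (h : Agree l m s s') (hl : l ⊆ l')
    (hm : m ⊆ m') : Agree l' m' s s' :=
  ⟨fun a ha => h.1 a fun h' => ha (hl h'), fun a ha => h.2 a fun h' => ha (hm h')⟩

/-- Frame rule: a program changes only the arrays to which it assigns. -/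
theorem Runs.agree {P : Program} {s s' : Memory} {t : ℕ} (h : Runs P s s' t) :
    Agree P.writesNat P.writesReal s s' := by
  induction h with
  | skip => exact Agree.refl _ _ _
  | assignNat a i x s =>
    refine ⟨fun b hb => ?_, fun b _ => rfl⟩
    simp only [Program.writesNat, List.mem_singleton] at hb
    simp [Function.update_of_ne hb]
  | assignReal a i x s =>
    refine ⟨fun b _ => rfl, fun b hb => ?_⟩
    simp only [Program.writesReal, List.mem_singleton] at hb
    simp [Function.update_of_ne hb]
  | seq _ _ ihP ihQ =>
    exact (ihP.mono (List.subset_append_left _ _) (List.subset_append_left _ _)).trans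
      (ihQ.mono (List.subset_append_right _ _) (List.subset_append_right _ _))
  | cond_true _ _ _ ih =>
    exact ih.mono (List.subset_append_left _ _) (List.subset_append_left _ _)
  | cond_false _ _ _ ih =>
    exact ih.mono (List.subset_append_right _ _) (List.subset_append_right _ _)
  | loop_done => exact Agree.refl _ _ _
  | loop_step _ _ _ ihP ihL => exact Agree.trans ihP ihL

/-- Total correctness with a time bound: started with memory `s`, the program `P` halts after at
most `T` time units with a memory that satisfies `post`. -/
def Achieves (P : Program) (s : Memory) (T : ℕ) (post : Memory → Prop) : Prop :=
  ∃ s' t, Runs P s s' t ∧ t ≤ T ∧ post s'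

namespace Achieves

variable {P Q : Program} {s : Memory} {T U : ℕ} {post post' : Memory → Prop}

theorem mono (h : Achieves P s T post) (hT : T ≤ U) (hp : ∀ s', post s' → post' s') :
    Achieves P s U post' := by
  obtain ⟨s', t, hr, ht, hs⟩ := h
  exact ⟨s', t, hr, ht.trans hT, hp _ hs⟩

theorem agree (h : Achieves P s T post) :
    Achieves P s T fun s' => post s' ∧ Agree P.writesNat P.writesReal s s' := by
  obtain ⟨s', t, hr, ht, hs⟩ := h
  exact ⟨s', t, hr, ht, hs, hr.agree⟩

theorem seq (hP : Achieves P s T fun s' => Achieves Q s' U post) :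
    Achieves (.seq P Q) s (T + U) post := by
  obtain ⟨s', t, hr, ht, s'', u, hr', hu, hs⟩ := hP
  exact ⟨s'', t + u, .seq hr hr', add_le_add ht hu, hs⟩

/-- Sequential composition, where the first part comes with its frame. -/
theorem seq_agree (hP : Achieves P s T post')
    (hQ : ∀ s', post' s' → Agree P.writesNat P.writesReal s s' → Achieves Q s' U post) :
    Achieves (.seq P Q) s (T + U) post :=
  seq (hP.agree.mono le_rfl fun s' h => hQ s' h.1 h.2)

theorem cond_neg {b : Test} (hb : ¬ b.Holds s) (hQ : Achieves Q s T post) :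
    Achieves (.cond b P Q) s (b.cost + 1 + T) post := by
  obtain ⟨s', t, hr, ht, hs⟩ := hQ
  exact ⟨s', _, .cond_false P hb hr, by omega, hs⟩

/-- The rule for loops. The index of the invariant counts the iterations, of which there are at
most `m`. -/
theorem loop {b : Test} {m : ℕ} (Inv : ℕ → Memory → Prop)
    (hstep : ∀ j s', Agree P.writesNat P.writesReal s s' → Inv j s' → b.Holds s' →
      j < m ∧ Achieves P s' T (Inv (j + 1)))
    (h0 : Inv 0 s) :
    Achieves (.loop b P) s (m * (T + b.cost + 1) + b.cost + 1)
      fun s' => (∃ j ≤ m, Inv j s') ∧ ¬ b.Holds s' := by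
  have key : ∀ d j s', j + d = m → Agree P.writesNat P.writesReal s s' → Inv j s' →
      Achieves (.loop b P) s' (d * (T + b.cost + 1) + b.cost + 1)
        fun s' => (∃ j ≤ m, Inv j s') ∧ ¬ b.Holds s' := by
    intro d
    induction d with
    | zero =>
      intro j s' hj hA hI
      have hb : ¬ b.Holds s' := fun hb => by have := (hstep j s' hA hI hb).1; omega
      exact ⟨s', _, .loop_done P hb, by omega, ⟨j, by omega, hI⟩, hb⟩
    | succ d ih =>
      intro j s' hj hA hI
      by_cases hb : b.Holds s'
      · obtain ⟨_, s₂, t, hr, ht, hI₂⟩ := hstep j s' hA hI hb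
        obtain ⟨s₃, u, hr', hu, h₃⟩ := ih (j + 1) s₂ (by omega) (hA.trans hr.agree) hI₂
        refine ⟨s₃, _, .loop_step hb hr hr', ?_, h₃⟩
        rw [Nat.add_mul]
        omega
      · exact ⟨s', _, .loop_done P hb, by rw [Nat.add_mul]; omega, ⟨j, by omega, hI⟩, hb⟩
  exact key m 0 s (by omega) (Agree.refl _ _ _) h0

end Achieves

/-! ### Straight-line code -/

/-- A program without loops. -/
def Program.LoopFree : Program → Bool
  | skip => true
  | assignNat _ _ _ => true
  | assignReal _ _ _ => true
  | seq P Q => P.LoopFree && Q.LoopFree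
  | cond _ P Q => P.LoopFree && Q.LoopFree
  | loop _ _ => false

open Classical in
/-- The final memory of a program without loops (and a junk value for loops). -/
noncomputable def Program.exec : Program → Memory → Memory
  | skip, s => s
  | assignNat a i x, s => s.setNat a (i.eval s) (x.eval s)
  | assignReal a i x, s => s.setReal a (i.eval s) (x.eval s)
  | seq P Q, s => Q.exec (P.exec s)
  | cond b P Q, s => if b.Holds s then P.exec s else Q.exec s
  | loop _ _, s => s

/-- An upper bound on the running time of a program without loops (and a junk value for loops). -/
def Program.cost : Program → ℕ
  | skip => 1
  | assignNat _ i x => i.cost + x.cost + 1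
  | assignReal _ i x => i.cost + x.cost + 1
  | seq P Q => P.cost + Q.cost
  | cond b P Q => b.cost + 1 + max P.cost Q.cost
  | loop _ _ => 0

theorem Achieves.straight {P : Program} {s : Memory} {T : ℕ} {post : Memory → Prop}
    (hP : P.LoopFree = true) (hT : P.cost ≤ T) (h : post (P.exec s)) : Achieves P s T post := by
  have key : ∀ P : Program, P.LoopFree = true → ∀ s, ∃ t, Runs P s (P.exec s) t ∧ t ≤ P.cost := by
    intro P
    induction P with
    | skip => exact fun _ s => ⟨_, .skip s, le_rfl⟩
    | assignNat a i x => exact fun _ s => ⟨_, .assignNat a i x s, le_rfl⟩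
    | assignReal a i x => exact fun _ s => ⟨_, .assignReal a i x s, le_rfl⟩
    | seq P Q ihP ihQ =>
      intro h s
      simp only [Program.LoopFree, Bool.and_eq_true] at h
      obtain ⟨t, hr, ht⟩ := ihP h.1 s
      obtain ⟨u, hr', hu⟩ := ihQ h.2 (P.exec s)
      exact ⟨t + u, .seq hr hr', add_le_add ht hu⟩
    | cond b P Q ihP ihQ =>
      intro h s
      simp only [Program.LoopFree, Bool.and_eq_true] at h
      by_cases hb : b.Holds s
      · obtain ⟨t, hr, ht⟩ := ihP h.1 s
        refine ⟨_, by simpa [Program.exec, hb] using Runs.cond_true Q hb hr, ?_⟩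
        exact Nat.add_le_add_left (ht.trans (le_max_left _ _)) _
      · obtain ⟨t, hr, ht⟩ := ihQ h.2 s
        refine ⟨_, by simpa [Program.exec, hb] using Runs.cond_false P hb hr, ?_⟩
        exact Nat.add_le_add_left (ht.trans (le_max_right _ _)) _
    | loop b P => intro h; simp [Program.LoopFree] at h
  obtain ⟨t, hr, ht⟩ := key P hP s
  exact ⟨_, t, hr, ht.trans hT, h⟩

/-! ### Counting loops -/

/-- The value of a scalar variable, kept in entry `0` of the natural number array `a`. -/
abbrev NatExpr.var (a : ℕ) : NatExpr := .get a (.const 0)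

/-- The value of a scalar variable, kept in entry `0` of the real array `a`. -/
abbrev RealExpr.var (a : ℕ) : RealExpr := .get a (.const 0)

/-- Assignment to a scalar variable of type `ℕ`. -/
abbrev Program.setN (a : ℕ) (x : NatExpr) : Program := .assignNat a (.const 0) x

/-- Assignment to a scalar variable of type `ℝ`. -/
abbrev Program.setR (a : ℕ) (x : RealExpr) : Program := .assignReal a (.const 0) x

/-- `forLoop a N P` runs `P` with the variable `a` taking the values `0, …, N - 1`. -/
def Program.forLoop (a : ℕ) (N : NatExpr) (P : Program) : Program :=
  .seq (.setN a (.const 0))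
    (.loop (.not (.natLE N (.var a))) (.seq P (.setN a (.add (.var a) (.const 1)))))

/-- The rule for counting loops: the value of `N` and the loop variable are not changed by the body,
and the invariant `Inv i` holds when the loop variable has just received the value `i`. -/
theorem Achieves.forLoop {a : ℕ} {N : NatExpr} {P : Program} {s : Memory} {n T : ℕ}
    (Inv : ℕ → Memory → Prop) (ha : a ∉ P.writesNat)
    (hN : ∀ s', Agree (a :: P.writesNat) P.writesReal s s' → N.eval s' = n)
    (h0 : Inv 0 (s.setNat a 0 0))
    (hstep : ∀ i s', i < n → Agree (a :: P.writesNat) P.writesReal s s' → s'.nat a 0 = i →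
      Inv i s' → Achieves P s' T fun s'' => Inv (i + 1) (s''.setNat a 0 (i + 1))) :
    Achieves (.forLoop a N P) s (n * (T + N.cost + 11) + N.cost + 8) (Inv n) := by
  have h1 : Agree (a :: P.writesNat) P.writesReal s (s.setNat a 0 0) := by
    refine ⟨fun b hb => ?_, fun b _ => rfl⟩
    simp only [List.mem_cons, not_or] at hb
    simp [Function.update_of_ne hb.1]
  have h2 : ∀ {s'}, Agree (Program.seq P (.setN a (.add (.var a) (.const 1)))).writesNat
      (Program.seq P (.setN a (.add (.var a) (.const 1)))).writesReal (s.setNat a 0 0) s' →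
      Agree (a :: P.writesNat) P.writesReal s s' := by
    intro s' h
    refine h1.trans (h.mono ?_ ?_)
    · intro b; simp [Program.writesNat]; tauto
    · intro b; simp [Program.writesReal]
  have hl := Achieves.loop (P := .seq P (.setN a (.add (.var a) (.const 1))))
    (b := .not (.natLE N (.var a))) (s := s.setNat a 0 0) (m := n) (T := T + 6)
    (fun j s' => j ≤ n ∧ s'.nat a 0 = j ∧ Inv j s')
    (by
      rintro j s' hA ⟨hj, hc, hI⟩ hb
      have hN' := hN s' (h2 hA)
      simp only [Test.Holds, NatExpr.eval, hN', hc, not_le] at hb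
      refine ⟨hb, ?_⟩
      refine Achieves.seq_agree (hstep j s' hb (h2 hA) hc hI) fun s'' h hA' => ?_
      have hc' : s''.nat a 0 = j := by rw [hA'.1 a ha, hc]
      refine Achieves.straight rfl (by simp [Program.cost, NatExpr.cost]) ?_
      simp only [Program.exec, NatExpr.eval, hc']
      exact ⟨hb, by simp, h⟩)
    ⟨Nat.zero_le _, by simp, h0⟩
  have hs : Achieves (.setN a (.const 0)) s 3 (fun s' => s' = s.setNat a 0 0) :=
    Achieves.straight rfl (by simp [Program.cost, NatExpr.cost])
      (by simp [Program.exec, NatExpr.eval])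
  have hl' : Achieves (.loop (.not (.natLE N (.var a)))
      (.seq P (.setN a (.add (.var a) (.const 1))))) (s.setNat a 0 0)
      (n * (T + N.cost + 11) + N.cost + 5) (Inv n) := by
    refine hl.agree.mono ?_ ?_
    · simp only [Test.cost, NatExpr.cost]
      have : T + 6 + (N.cost + (1 + 1) + 1 + 1) + 1 = T + N.cost + 11 := by ring
      rw [this]; omega
    · rintro s' ⟨⟨⟨j, -, hj, hc, hI⟩, hb⟩, hA⟩
      simp only [Test.Holds, NatExpr.eval, hN s' (h2 hA), hc, not_not] at hb
      obtain rfl : j = n := le_antisymm hj hb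
      exact hI
  exact (Achieves.seq (hs.mono le_rfl fun s' h => by subst h; exact hl')).mono (by omega)
    fun _ h => h

end RealRAM

/-! ### Computing the classes

The program uses the following arrays besides the input; a scalar variable is entry `0` of its
array. Natural number arrays: `1` the output, `2` the classes of the products, `3` their ranks in
the classes, `4` the powers of the base, `5` and `6` quotients and remainders modulo the base, `7`
the digits of the current state, `8` the optimal choices; scalars `10`, `11`, `13`, `15`, `18` for
loops and auxiliary values, `12` the number of classes, `14` the current state, `16` the number of
products used in it, `17` an address. Real arrays: `8` the values of the states; scalars `4` the
largest share and then the threshold, `5` an auxiliary value, `6` the total weight of the used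
products, `7` the proportion of the customers who have not stopped. -/

namespace RealRAM

/-- The purchase probability `x / (1 + x)` of a consideration set of total weight `x`. -/
noncomputable def share (x : ℝ) : ℝ := x / (1 + x)

/-- The expression for `share`. -/
def RealExpr.share (x : RealExpr) : RealExpr := .div x (.add (.ofNat (.const 1)) x)

theorem RealExpr.share_eval (s : Memory) (x : RealExpr) :
    x.share.eval s = RealRAM.share (x.eval s) := by
  simp [RealExpr.share, RealRAM.share, RealExpr.eval, NatExpr.eval]

/-- The number of products. -/
abbrev NatExpr.numProducts : NatExpr := .get 0 (.const 0)

/-- The number of customers. -/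
abbrev NatExpr.numCustomers : NatExpr := .get 0 (.const 1)

/-- Compute the largest share of a single product, and from it the threshold below which products
are considered to be light. -/
def thresholdProgram : Program :=
  .seq
    (.forLoop 10 .numProducts
      (.cond (.realLE (.var 4) (.share (.get 1 (.var 10))))
        (.setR 4 (.share (.get 1 (.var 10)))) .skip))
    (.setR 4 (.div (.mul (.var 0) (.var 4)) (.mul (.ofNat (.const 4)) (.ofNat .numProducts))))

theorem thresholdProgram_spec {s : Memory} {n : ℕ} {w : ℕ → ℝ} {ε : ℝ} (hn : s.nat 0 0 = n)
    (hw : s.real 1 = w) (hε : s.real 0 0 = ε) (h0 : s.real 4 0 = 0) :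
    Achieves thresholdProgram s (100 * (n + 1)) fun s' => ∃ gm : ℝ, 0 ≤ gm ∧
      (∀ i < n, share (w i) ≤ gm) ∧ (gm = 0 ∨ ∃ i < n, gm = share (w i)) ∧
      s'.real 4 0 = ε * gm / (4 * n) := by
  have hl := Achieves.forLoop (a := 10) (N := .numProducts) (n := n) (T := 30) (s := s)
    (P := .cond (.realLE (.var 4) (.share (.get 1 (.var 10))))
        (.setR 4 (.share (.get 1 (.var 10)))) .skip)
    (fun i s' => 0 ≤ s'.real 4 0 ∧ (∀ i' < i, share (w i') ≤ s'.real 4 0) ∧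
      (s'.real 4 0 = 0 ∨ ∃ i' < n, s'.real 4 0 = share (w i'))) (by decide)
    (fun s' hA => by simp [NatExpr.eval, hA.1 0 (by decide), hn])
    (by simp [h0])
    (fun i s' hi hA hc ⟨h1, h2, h3⟩ => by
      refine Achieves.straight rfl (by decide) ?_
      have e1 : s'.real 1 = w := by rw [hA.2 1 (by decide), hw]
      simp only [Program.exec, Test.Holds, RealExpr.share_eval, RealExpr.eval, NatExpr.eval, hc, e1]
      split_ifs with h
      · simp only [Memory.setNat_real, Memory.setReal_real, Function.update_self]
        refine ⟨h1.trans h, fun i' hi' => ?_, Or.inr ⟨i, hi, rfl⟩⟩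
        rcases Nat.lt_succ_iff_lt_or_eq.1 hi' with h' | rfl
        · exact (h2 i' h').trans h
        · exact le_rfl
      · refine ⟨h1, fun i' hi' => ?_, h3⟩
        rcases Nat.lt_succ_iff_lt_or_eq.1 hi' with h' | rfl
        · exact h2 i' h'
        · exact (not_le.1 h).le)
  refine (Achieves.seq_agree (U := 30) hl fun s' ⟨h1, h2, h3⟩ hA => ?_).mono ?_ fun _ h => h
  · refine Achieves.straight rfl (by decide) ⟨_, h1, h2, h3, ?_⟩
    simp [Program.exec, RealExpr.eval, NatExpr.eval, hA.1 0 (by decide), hA.2 0 (by decide), hn, hε]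
  · simp only [NatExpr.cost]; omega

/-- Compute the classes of the products and the number of classes. Product `i` belongs to class `j`
if `j` is minimal such that its share is at most `τ * (1 + ε / 2) ^ j`, where `τ` is the
threshold. -/
def classProgram : Program :=
  .forLoop 10 .numProducts
    (.seq (.seq (.setR 5 (.var 4)) (.setN 11 (.const 0)))
      (.seq
        (.loop (.not (.realLE (.share (.get 1 (.var 10))) (.var 5)))
          (.seq (.setR 5 (.mul (.var 5)
              (.add (.ofNat (.const 1)) (.div (.var 0) (.ofNat (.const 2))))))
            (.setN 11 (.add (.var 11) (.const 1)))))
        (.seq (.assignNat 2 (.var 10) (.var 11))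
          (.cond (.natLE (.var 12) (.var 11)) (.setN 12 (.add (.var 11) (.const 1))) .skip))))

/-- `cl` assigns to each product the class of its share `g i` for the threshold `τ` and the
ratio `ρ`: the least `j` such that the share is at most `τ * ρ ^ j`. -/
def IsClassification (n : ℕ) (g : ℕ → ℝ) (τ ρ : ℝ) (cl : ℕ → ℕ) : Prop :=
  ∀ i < n, g i ≤ τ * ρ ^ cl i ∧ ∀ j < cl i, τ * ρ ^ j < g i

/-- The hypothesis on `M` makes the search for the class of a product end after `M` steps. This
includes the case that all weights are zero: then `τ = 0`, and all products are in class `0`. -/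
theorem classProgram_spec {s : Memory} {n M : ℕ} {w : ℕ → ℝ} {ε τ : ℝ} (hn : s.nat 0 0 = n)
    (hw : s.real 1 = w) (hε : s.real 0 0 = ε) (hτ : s.real 4 0 = τ) (hL : s.nat 12 0 = 0)
    (hM : ∀ i < n, share (w i) ≤ τ * (1 + ε / 2) ^ M) :
    Achieves classProgram s (200 * (n + 1) * (M + 1)) fun s' =>
      IsClassification n (fun i => share (w i)) τ (1 + ε / 2) (s'.nat 2) ∧
      (∀ i < n, s'.nat 2 i < s'.nat 12 0) ∧ s'.nat 12 0 ≤ M + 1 := by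
  refine (Achieves.forLoop (a := 10) (N := .numProducts) (n := n) (T := 100 * (M + 1))
    (fun i s' => IsClassification i (fun i => share (w i)) τ (1 + ε / 2) (s'.nat 2) ∧
      (∀ i' < i, s'.nat 2 i' < s'.nat 12 0) ∧ s'.nat 12 0 ≤ M + 1) (by decide)
    (fun s' hA => by simp [NatExpr.eval, hA.1 0 (by decide), hn])
    (by simp [hL, IsClassification]) ?_).mono ?_ fun _ h => h
  · intro i s₁ hi hA hc ⟨h1, h2, h3⟩
    have e1 : s₁.real 1 = w := by rw [hA.2 1 (by decide), hw]
    have e2 : s₁.real 0 0 = ε := by rw [hA.2 0 (by decide), hε]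
    have e3 : s₁.real 4 0 = τ := by rw [hA.2 4 (by decide), hτ]
    refine (Achieves.seq_agree (T := 10) (U := 90 * M + 90)
      (post' := fun s' => s'.real 5 0 = τ ∧ s'.nat 11 0 = 0)
      (Achieves.straight rfl (by decide) (by simp [Program.exec, RealExpr.eval, NatExpr.eval, e3]))
      ?_).mono (by omega) fun _ h => h
    intro s₂ ⟨f1, f2⟩ hA₂
    have hl := Achieves.loop (s := s₂) (T := 30) (m := M)
      (b := .not (.realLE (.share (.get 1 (.var 10))) (.var 5)))
      (P := .seq (.setR 5 (.mul (.var 5)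
              (.add (.ofNat (.const 1)) (.div (.var 0) (.ofNat (.const 2))))))
            (.setN 11 (.add (.var 11) (.const 1))))
      (fun j s' => s'.nat 11 0 = j ∧ s'.real 5 0 = τ * (1 + ε / 2) ^ j ∧
        ∀ j' < j, τ * (1 + ε / 2) ^ j' < share (w i))
      (by
        rintro j s' hA' ⟨g1, g2, g3⟩ hb
        have e1' : s'.real 1 = w := by rw [hA'.2 1 (by decide), hA₂.2 1 (by decide), e1]
        have e2' : s'.real 0 0 = ε := by rw [hA'.2 0 (by decide), hA₂.2 0 (by decide), e2]
        have hc' : s'.nat 10 0 = i := by rw [hA'.1 10 (by decide), hA₂.1 10 (by decide), hc]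
        simp only [Test.Holds, RealExpr.share_eval, RealExpr.eval, NatExpr.eval, g2, e1', hc',
          not_le] at hb
        have g3' : ∀ j' < j + 1, τ * (1 + ε / 2) ^ j' < share (w i) := by
          intro j' hj'
          rcases Nat.lt_succ_iff_lt_or_eq.1 hj' with h' | rfl
          · exact g3 j' h'
          · exact hb
        refine ⟨?_, Achieves.straight rfl (by decide) ?_⟩
        · by_contra hj
          exact absurd (g3' M (by omega)) (not_lt.2 (hM i hi))
        · simp [Program.exec, RealExpr.eval, NatExpr.eval, g1, g2, e2', pow_succ, mul_assoc]
          exact fun j' hj' => g3' j' (by omega))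
      ⟨f2, by simp [f1], by simp⟩
    refine (Achieves.seq_agree (U := 30) hl ?_).mono ?_ fun _ h => h
    · rintro s₃ ⟨⟨j, hj, g1, g2, g3⟩, hb⟩ hA₃
      have e1' : s₃.real 1 = w := by rw [hA₃.2 1 (by decide), hA₂.2 1 (by decide), e1]
      have hc' : s₃.nat 10 0 = i := by rw [hA₃.1 10 (by decide), hA₂.1 10 (by decide), hc]
      have e4 : s₃.nat 2 = s₁.nat 2 := by rw [hA₃.1 2 (by decide), hA₂.1 2 (by decide)]
      have e5 : s₃.nat 12 = s₁.nat 12 := by rw [hA₃.1 12 (by decide), hA₂.1 12 (by decide)]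
      simp only [Test.Holds, RealExpr.share_eval, RealExpr.eval, NatExpr.eval, g2, e1', hc',
        not_not] at hb
      refine Achieves.straight rfl (by decide) ?_
      have key : ∀ v : ℕ, s₁.nat 12 0 ≤ v → j < v → v ≤ M + 1 →
          IsClassification (i + 1) (fun i => share (w i)) τ (1 + ε / 2)
            (Function.update (s₁.nat 2) i j) ∧
          (∀ i' < i + 1, Function.update (s₁.nat 2) i j i' < v) ∧ v ≤ M + 1 := by
        refine fun v hv hjv hvM => ⟨fun i' hi' => ?_, fun i' hi' => ?_, hvM⟩
        · rcases Nat.lt_succ_iff_lt_or_eq.1 hi' with h' | rfl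
          · simpa [Function.update_of_ne h'.ne] using h1 i' h'
          · simpa using ⟨hb, g3⟩
        · rcases Nat.lt_succ_iff_lt_or_eq.1 hi' with h' | rfl
          · simpa [Function.update_of_ne h'.ne] using (h2 i' h').trans_le hv
          · simpa using hjv
      simp only [Program.exec, NatExpr.eval, Test.Holds, Memory.setNat_nat, hc', e4, g1]
      simp only [ne_eq, Nat.reduceEqDiff, not_false_eq_true,
        Function.update_of_ne, e5, g1]
      split_ifs with h
      · simpa [hc', e4, g1] using key (j + 1) (by omega) (by omega) (by omega)
      · simpa [hc', e4, e5, g1] using key (s₁.nat 12 0) le_rfl (by omega) h3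
    · simp only [Test.cost, RealExpr.cost, RealExpr.share, NatExpr.cost]; omega
  · simp only [NatExpr.cost]
    have h1 : n * (100 * (M + 1) + (1 + 1) + 11) ≤ n * (113 * (M + 1)) :=
      Nat.mul_le_mul_left _ (by omega)
    have h2 : n * (113 * (M + 1)) = 113 * (n * (M + 1)) := by ring
    have h3 : 200 * (n + 1) * (M + 1) = 200 * (n * (M + 1)) + 200 * (M + 1) := by ring
    omega

/-! ### Computing the ranks and the arithmetic of codes -/

/-- The order in which the products of a class are used: by increasing weight, with ties broken by
the index. -/
def Precedes (w : ℕ → ℝ) (i' i : ℕ) : Prop := w i' ≤ w i ∧ ¬ (w i ≤ w i' ∧ i ≤ i')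

open Classical in
/-- The number of products that precede product `i` in its class. -/
noncomputable def rank (n : ℕ) (w : ℕ → ℝ) (cl : ℕ → ℕ) (i : ℕ) : ℕ :=
  ((Finset.range n).filter fun i' => cl i' = cl i ∧ Precedes w i' i).card

/-- Compute the ranks of the products in their classes. -/
def rankProgram : Program :=
  .forLoop 10 .numProducts
    (.seq (.assignNat 3 (.var 10) (.const 0))
      (.forLoop 11 .numProducts
        (.cond
          (.and (.and (.natLE (.get 2 (.var 11)) (.get 2 (.var 10)))
              (.natLE (.get 2 (.var 10)) (.get 2 (.var 11))))
            (.and (.realLE (.get 1 (.var 11)) (.get 1 (.var 10)))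
              (.not (.and (.realLE (.get 1 (.var 10)) (.get 1 (.var 11)))
                (.natLE (.var 10) (.var 11))))))
          (.assignNat 3 (.var 10) (.add (.get 3 (.var 10)) (.const 1))) .skip)))

theorem rankProgram_spec {s : Memory} {n : ℕ} {w : ℕ → ℝ} {cl : ℕ → ℕ} (hn : s.nat 0 0 = n)
    (hw : s.real 1 = w) (hcl : s.nat 2 = cl) :
    Achieves rankProgram s (200 * (n + 1) * (n + 1)) fun s' =>
      ∀ i < n, s'.nat 3 i = rank n w cl i := by
  classical
  refine (Achieves.forLoop (a := 10) (N := .numProducts) (n := n) (T := 100 * n + 50)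
    (fun i s' => ∀ i' < i, s'.nat 3 i' = rank n w cl i') (by decide)
    (fun s' hA => by simp [NatExpr.eval, hA.1 0 (by decide), hn]) (by simp) ?_).mono ?_ fun _ h => h
  · intro i s₁ hi hA hc h1
    have e1 : s₁.real 1 = w := by rw [hA.2 1 (by decide), hw]
    have e2 : s₁.nat 2 = cl := by rw [hA.1 2 (by decide), hcl]
    have e3 : s₁.nat 0 0 = n := by rw [hA.1 0 (by decide), hn]
    refine (Achieves.seq_agree (T := 10) (U := 100 * n + 40)
      (post' := fun s' => s'.nat 3 i = 0 ∧ ∀ i' < i, s'.nat 3 i' = rank n w cl i')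
      (Achieves.straight rfl (by decide) ?_) ?_).mono (by omega) fun _ h => h
    · simp only [Program.exec, NatExpr.eval, Memory.setNat_nat, hc, Function.update_self, true_and]
      intro i' hi'
      rw [Function.update_of_ne hi'.ne, h1 i' hi']
    intro s₂ ⟨f1, f2⟩ hA₂
    refine (Achieves.forLoop (a := 11) (N := .numProducts) (n := n) (T := 60)
      (fun m s' => s'.nat 3 i =
          ((Finset.range m).filter fun i' => cl i' = cl i ∧ Precedes w i' i).card ∧
        ∀ i' < i, s'.nat 3 i' = rank n w cl i') (by decide)
      (fun s' hA' => by simp [NatExpr.eval, hA'.1 0 (by decide), hA₂.1 0 (by decide), e3])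
      (by simpa [f1] using f2) ?_).mono ?_ ?_
    · intro m s' hm hA' hc' ⟨g1, g2⟩
      have e1' : s'.real 1 = w := by rw [hA'.2 1 (by decide), hA₂.2 1 (by decide), e1]
      have e2' : s'.nat 2 = cl := by rw [hA'.1 2 (by decide), hA₂.1 2 (by decide), e2]
      have e3' : s'.nat 10 0 = i := by rw [hA'.1 10 (by decide), hA₂.1 10 (by decide), hc]
      refine Achieves.straight rfl (by decide) ?_
      have hiff : ((cl m ≤ cl i ∧ cl i ≤ cl m) ∧ w m ≤ w i ∧ ¬ (w i ≤ w m ∧ i ≤ m)) ↔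
          (cl m = cl i ∧ Precedes w m i) := by
        rw [Precedes, le_antisymm_iff]
      simp only [Program.exec, Test.Holds, RealExpr.eval, NatExpr.eval, e1', e2', e3', hc', hiff]
      rw [Finset.range_add_one, Finset.filter_insert]
      split_ifs with h
      · refine ⟨?_, fun i' hi' => ?_⟩
        · rw [Finset.card_insert_of_notMem (by simp)]
          simp [g1]
        · simp [hi'.ne, g2 i' hi']
      · simpa [g1] using g2
    · simp only [NatExpr.cost]; omega
    · rintro s' ⟨g1, g2⟩ i' hi'
      simp only [Memory.setNat_nat, ne_eq, Nat.reduceEqDiff, not_false_eq_true,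
        Function.update_of_ne]
      rcases Nat.lt_succ_iff_lt_or_eq.1 hi' with h' | rfl
      · exact g2 i' h'
      · exact g1
  · simp only [NatExpr.cost]
    have h2 : n * (100 * n + 50 + (1 + 1) + 11) = 100 * (n * n) + 63 * n := by ring
    have h3 : 200 * (n + 1) * (n + 1) = 200 * (n * n) + 400 * n + 200 := by ring
    omega

/-- Compute the powers of the base `n + 1`, up to the number of classes. -/
def powProgram : Program :=
  .seq (.assignNat 4 (.const 0) (.const 1))
    (.forLoop 11 (.var 12)
      (.seq (.assignNat 4 (.add (.var 11) (.const 1)) (.const 0))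
        (.forLoop 15 (.add .numProducts (.const 1))
          (.assignNat 4 (.add (.var 11) (.const 1))
            (.add (.get 4 (.add (.var 11) (.const 1))) (.get 4 (.var 11)))))))

theorem powProgram_spec {s : Memory} {n L : ℕ} (hn : s.nat 0 0 = n) (hL : s.nat 12 0 = L) :
    Achieves powProgram s (200 * (n + 1) * (L + 1)) fun s' =>
      ∀ j ≤ L, s'.nat 4 j = (n + 1) ^ j := by
  refine (Achieves.seq_agree (T := 10) (U := L * (50 * n + 130) + 50)
    (post' := fun s' => s'.nat 4 0 = 1)
    (Achieves.straight rfl (by decide) (by simp [Program.exec, NatExpr.eval])) ?_).mono ?_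
    fun _ h => h
  swap
  · have h2 : L * (50 * n + 130) = 50 * (n * L) + 130 * L := by ring
    have h3 : 200 * (n + 1) * (L + 1) = 200 * (n * L) + 200 * L + 200 * n + 200 := by ring
    omega
  intro s₀ f0 hA₀
  refine (Achieves.forLoop (a := 11) (N := .var 12) (n := L) (T := 50 * n + 110)
    (fun i s' => ∀ j ≤ i, s'.nat 4 j = (n + 1) ^ j) (by decide)
    (fun s' hA => by simp [NatExpr.eval, hA.1 12 (by decide), hA₀.1 12 (by decide), hL])
    (by simp [f0]) ?_).mono ?_ fun _ h => h
  · intro i s₁ hi hA hc h1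
    have e3 : s₁.nat 0 0 = n := by rw [hA.1 0 (by decide), hA₀.1 0 (by decide), hn]
    refine (Achieves.seq_agree (T := 10) (U := 50 * n + 100)
      (post' := fun s' => s'.nat 4 (i + 1) = 0 ∧ ∀ j ≤ i, s'.nat 4 j = (n + 1) ^ j)
      (Achieves.straight rfl (by decide) ?_) ?_).mono (by omega) fun _ h => h
    · simp only [Program.exec, NatExpr.eval, Memory.setNat_nat, hc, Function.update_self, true_and]
      intro j hj
      rw [Function.update_of_ne (by omega), h1 j hj]
    intro s₂ ⟨f1, f2⟩ hA₂
    refine (Achieves.forLoop (a := 15) (N := .add .numProducts (.const 1)) (n := n + 1) (T := 30)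
      (fun m s' => s'.nat 4 (i + 1) = m * (n + 1) ^ i ∧ ∀ j ≤ i, s'.nat 4 j = (n + 1) ^ j)
      (by decide)
      (fun s' hA' => by simp [NatExpr.eval, hA'.1 0 (by decide), hA₂.1 0 (by decide), e3])
      (by simpa [f1] using f2) ?_).mono ?_ ?_
    · intro m s' hm hA' hc' ⟨g1, g2⟩
      have e3' : s'.nat 11 0 = i := by rw [hA'.1 11 (by decide), hA₂.1 11 (by decide), hc]
      refine Achieves.straight rfl (by decide) ⟨?_, fun j hj => ?_⟩
      · simp [Program.exec, NatExpr.eval, e3', g1, g2 i le_rfl]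
        ring
      · simp [Program.exec, NatExpr.eval, e3', (show j ≠ i + 1 by omega), g2 j hj]
    · simp only [NatExpr.cost]; omega
    · rintro s' ⟨g1, g2⟩ j hj
      simp only [Memory.setNat_nat, ne_eq, Nat.reduceEqDiff, not_false_eq_true,
        Function.update_of_ne]
      rcases Nat.lt_succ_iff_lt_or_eq.1 (Nat.lt_succ_of_le hj) with h' | rfl
      · exact g2 j (by omega)
      · rw [g1, pow_succ, mul_comm]
  · simp only [NatExpr.cost]
    have : 50 * n + 110 + (1 + 1) + 11 ≤ 50 * n + 130 := by omega
    have := Nat.mul_le_mul_left L this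
    omega

/-- Tabulate quotients and remainders of the codes of states modulo the base `n + 1`. -/
def divModProgram : Program :=
  .forLoop 13 (.get 4 (.var 12))
    (.cond (.natLE (.add (.get 6 (.var 13)) (.const 1)) .numProducts)
      (.seq (.assignNat 5 (.add (.var 13) (.const 1)) (.get 5 (.var 13)))
        (.assignNat 6 (.add (.var 13) (.const 1)) (.add (.get 6 (.var 13)) (.const 1))))
      (.seq (.assignNat 5 (.add (.var 13) (.const 1)) (.add (.get 5 (.var 13)) (.const 1)))
        (.assignNat 6 (.add (.var 13) (.const 1)) (.const 0))))

theorem divModProgram_spec {s : Memory} {n L N : ℕ} (hn : s.nat 0 0 = n) (hL : s.nat 12 0 = L)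
    (hN : s.nat 4 L = N) (h5 : s.nat 5 0 = 0) (h6 : s.nat 6 0 = 0) :
    Achieves divModProgram s (200 * (N + 1)) fun s' =>
      ∀ x ≤ N, s'.nat 5 x = x / (n + 1) ∧ s'.nat 6 x = x % (n + 1) := by
  refine (Achieves.forLoop (a := 13) (N := .get 4 (.var 12)) (n := N) (T := 50)
    (fun z s' => ∀ x ≤ z, s'.nat 5 x = x / (n + 1) ∧ s'.nat 6 x = x % (n + 1)) (by decide)
    (fun s' hA => by simp [NatExpr.eval, hA.1 12 (by decide), hA.1 4 (by decide), hL, hN])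
    (by simp [h5, h6]) ?_).mono ?_ fun _ h => h
  · intro z s' hz hA hc h
    have e : s'.nat 0 0 = n := by rw [hA.1 0 (by decide), hn]
    refine Achieves.straight rfl (by decide) ?_
    have key : (z + 1) / (n + 1) = (if z % (n + 1) + 1 ≤ n then z / (n + 1) else z / (n + 1) + 1) ∧
        (z + 1) % (n + 1) = if z % (n + 1) + 1 ≤ n then z % (n + 1) + 1 else 0 := by
      have h1 := Nat.div_add_mod z (n + 1)
      have h2 := Nat.mod_lt z (Nat.succ_pos n)
      generalize z / (n + 1) = q at *
      generalize z % (n + 1) = r at *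
      subst h1
      split_ifs with hr
      · rw [add_assoc, Nat.mul_add_div (by omega), Nat.mul_add_mod, Nat.div_eq_of_lt (by omega),
          Nat.mod_eq_of_lt (by omega)]
        exact ⟨rfl, rfl⟩
      · obtain rfl : r = n := by omega
        rw [add_assoc, Nat.mul_add_div (by omega), Nat.mul_add_mod, Nat.div_self (by omega),
          Nat.mod_self]
        exact ⟨rfl, rfl⟩
    intro x hx
    obtain ⟨q1, q2⟩ := h z le_rfl
    simp only [Program.exec, Test.Holds, NatExpr.eval, hc, e, q2]
    rcases Nat.lt_succ_iff_lt_or_eq.1 (Nat.lt_succ_of_le hx) with h' | rfl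
    · have hx' : x ≠ z + 1 := by omega
      split_ifs <;> simpa [hc, hx'] using h x (by omega)
    · rw [key.1, key.2]
      split_ifs <;> simp [hc, q1, q2]
  · simp only [NatExpr.cost]; omega

/-! ### The tables of the dynamic program -/

/-- The data on which the dynamic program works: an instance, the classes of the products, and their
ranks within the classes. A state is a vector of numbers of products used from each class, coded by
the number of which these are the digits in base `n + 1`; the used products of a class are those of
least rank. -/
structure Tables where
  n : ℕ
  K : ℕ
  w : ℕ → ℝ
  θ : ℕ → ℝ
  r : ℕ → ℝ
  cl : ℕ → ℕ
  rk : ℕ → ℕ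

namespace Tables

variable (D : Tables)

/-- The number of products of class `j` used in state `x`. -/
def digit (x j : ℕ) : ℕ := x / (D.n + 1) ^ j % (D.n + 1)

/-- Product `i` is the next product of its class to be used in state `x`. -/
def Next (x i : ℕ) : Prop := D.rk i = D.digit x (D.cl i)

/-- The total weight of the used products. -/
noncomputable def weight (x : ℕ) : ℝ :=
  ∑ i ∈ Finset.range D.n, if D.rk i < D.digit x (D.cl i) then D.w i else 0

/-- The number of used products. -/
def card (x : ℕ) : ℕ :=
  ∑ i ∈ Finset.range D.n, if D.rk i < D.digit x (D.cl i) then 1 else 0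

open Classical in
/-- The total proportion of the customers who have not yet stopped when the used products have been
inspected. -/
noncomputable def active (x : ℕ) : ℝ :=
  ∑ k ∈ Finset.range D.K,
    if 1 ≤ D.card x ∧ D.r (D.card x + k * D.n - 1) ≤ D.weight x then 0 else D.θ k

/-- The value of using product `i` next in state `x`, if `V` gives the values of the later states.
-/
noncomputable def candidate (V : ℕ → ℝ) (x i : ℕ) : ℝ :=
  V (x + (D.n + 1) ^ D.cl i) + D.active x * (share (D.weight x + D.w i) - share (D.weight x))

/-- The Bellman equation at state `x`, with `arg x` as an optimal choice. -/
def Bellman (V : ℕ → ℝ) (arg : ℕ → ℕ) (x : ℕ) : Prop :=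
  (∀ i < D.n, D.Next x i → D.candidate V x i ≤ V x) ∧
  ((∃ i < D.n, D.Next x i) →
    arg x < D.n ∧ D.Next x (arg x) ∧ V x = D.candidate V x (arg x)) ∧
  ((¬ ∃ i < D.n, D.Next x i) → V x = 0)

theorem candidate_congr {V V' : ℕ → ℝ} {x : ℕ} (h : ∀ y, x < y → V' y = V y) (i : ℕ) :
    D.candidate V' x i = D.candidate V x i := by
  rw [candidate, candidate, h]
  exact Nat.lt_add_of_pos_right (by positivity)

theorem Bellman.congr {D : Tables} {V V' : ℕ → ℝ} {arg arg' : ℕ → ℕ} {x : ℕ}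
    (hB : D.Bellman V arg x) (hV : ∀ y, x ≤ y → V' y = V y) (ha : arg' x = arg x) :
    D.Bellman V' arg' x := by
  have h := D.candidate_congr (V := V) (V' := V') (x := x) fun y hy => hV y hy.le
  simp only [Bellman, h, hV x le_rfl, ha]
  exact hB

theorem share_mono {x y : ℝ} (hx : 0 ≤ x) (hxy : x ≤ y) : share x ≤ share y := by
  rw [share, share, div_le_div_iff₀ (by linarith) (by linarith)]
  nlinarith

theorem weight_nonneg (hw : ∀ i < D.n, 0 ≤ D.w i) (x : ℕ) : 0 ≤ D.weight x := by
  refine Finset.sum_nonneg fun i hi => ?_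
  split_ifs
  exacts [hw i (Finset.mem_range.1 hi), le_rfl]

theorem active_nonneg (hθ : ∀ k < D.K, 0 ≤ D.θ k) (x : ℕ) : 0 ≤ D.active x := by
  classical
  refine Finset.sum_nonneg fun k hk => ?_
  split_ifs
  exacts [le_rfl, hθ k (Finset.mem_range.1 hk)]

theorem candidate_nonneg (hw : ∀ i < D.n, 0 ≤ D.w i) (hθ : ∀ k < D.K, 0 ≤ D.θ k) {V : ℕ → ℝ}
    (hV : ∀ y, 0 ≤ V y) (x : ℕ) {i : ℕ} (hi : i < D.n) : 0 ≤ D.candidate V x i := by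
  have h1 := D.weight_nonneg hw x
  have h2 := share_mono h1 (le_add_of_nonneg_right (hw i hi))
  exact add_nonneg (hV _) (mul_nonneg (D.active_nonneg hθ x) (sub_nonneg.2 h2))

end Tables

/-- The memory `s` holds the tables `D` with `L` classes, the powers of the base `D.n + 1`, and the
quotients and remainders modulo the base. -/
structure Ready (D : Tables) (L : ℕ) (s : Memory) : Prop where
  n : s.nat 0 0 = D.n
  K : s.nat 0 1 = D.K
  w : s.real 1 = D.w
  θ : s.real 2 = D.θ
  r : s.real 3 = D.r
  cl : s.nat 2 = D.cl
  rk : s.nat 3 = D.rk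
  numClasses : s.nat 12 0 = L
  pow : ∀ j ≤ L, s.nat 4 j = (D.n + 1) ^ j
  div : ∀ x < (D.n + 1) ^ L, s.nat 5 x = x / (D.n + 1) ∧ s.nat 6 x = x % (D.n + 1)

theorem Ready.of_agree {D : Tables} {L : ℕ} {s s' : Memory} {l m : List ℕ} (h : Ready D L s)
    (hA : Agree l m s s') (hl : ∀ a ∈ [0, 2, 3, 4, 5, 6, 12], a ∉ l)
    (hm : ∀ a ∈ [1, 2, 3], a ∉ m) : Ready D L s' := by
  have e0 := hA.1 0 (hl 0 (by decide))
  have e2 := hA.1 2 (hl 2 (by decide))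
  have e3 := hA.1 3 (hl 3 (by decide))
  have e4 := hA.1 4 (hl 4 (by decide))
  have e5 := hA.1 5 (hl 5 (by decide))
  have e6 := hA.1 6 (hl 6 (by decide))
  have e12 := hA.1 12 (hl 12 (by decide))
  have f1 := hA.2 1 (hm 1 (by decide))
  have f2 := hA.2 2 (hm 2 (by decide))
  have f3 := hA.2 3 (hm 3 (by decide))
  constructor
  · rw [e0, h.n]
  · rw [e0, h.K]
  · rw [f1, h.w]
  · rw [f2, h.θ]
  · rw [f3, h.r]
  · rw [e2, h.cl]
  · rw [e3, h.rk]
  · rw [e12, h.numClasses]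
  · rw [e4]; exact h.pow
  · rw [e5, e6]; exact h.div

/-! ### Processing a state -/

/-- Compute the digits of the code of the current state. -/
def digitProgram : Program :=
  .seq (.setN 15 (.var 14))
    (.forLoop 11 (.var 12)
      (.seq (.assignNat 7 (.var 11) (.get 6 (.var 15))) (.setN 15 (.get 5 (.var 15)))))

theorem digitProgram_spec {D : Tables} {L x : ℕ} {s : Memory} (hs : Ready D L s)
    (hx : s.nat 14 0 = x) (hxN : x < (D.n + 1) ^ L) :
    Achieves digitProgram s (100 * (L + 1)) fun s' => ∀ j < L, s'.nat 7 j = D.digit x j := by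
  refine (Achieves.seq_agree (T := 10) (U := 50 * L + 20)
    (post' := fun s' => s'.nat 15 0 = x)
    (Achieves.straight rfl (by decide) (by simp [Program.exec, NatExpr.eval, hx])) ?_).mono
    (by omega) fun _ h => h
  intro s₀ f0 hA₀
  have hs₀ := hs.of_agree hA₀ (by decide) (by decide)
  refine (Achieves.forLoop (a := 11) (N := .var 12) (n := L) (T := 30)
    (fun i s' => s'.nat 15 0 = x / (D.n + 1) ^ i ∧ ∀ j < i, s'.nat 7 j = D.digit x j) (by decide)
    (fun s' hA => by simp [NatExpr.eval, hA.1 12 (by decide), hs₀.numClasses])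
    (by simp [f0]) ?_).mono ?_ fun _ h => h.2
  · intro i s₁ hi hA hc ⟨h1, h2⟩
    have hs₁ := hs₀.of_agree hA (by decide) (by decide)
    have hlt : x / (D.n + 1) ^ i < (D.n + 1) ^ L := (Nat.div_le_self _ _).trans_lt hxN
    refine Achieves.straight rfl (by decide) ⟨?_, fun j hj => ?_⟩
    · simp [Program.exec, NatExpr.eval, hc, h1, (hs₁.div _ hlt).1, pow_succ, Nat.div_div_eq_div_mul]
    · rcases Nat.lt_succ_iff_lt_or_eq.1 hj with h' | rfl
      · simp [Program.exec, NatExpr.eval, hc, h'.ne, h2 j h']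
      · simp [Program.exec, NatExpr.eval, hc, h1, (hs₁.div _ hlt).2, Tables.digit]
  · simp only [NatExpr.cost]; omega

/-- Compute weight and number of the products used in the current state. -/
def weightProgram : Program :=
  .seq (.seq (.setR 6 (.ofNat (.const 0))) (.setN 16 (.const 0)))
    (.forLoop 10 .numProducts
      (.cond (.not (.natLE (.get 7 (.get 2 (.var 10))) (.get 3 (.var 10))))
        (.seq (.setR 6 (.add (.var 6) (.get 1 (.var 10))))
          (.setN 16 (.add (.var 16) (.const 1)))) .skip))

theorem weightProgram_spec {D : Tables} {L x : ℕ} {s : Memory} (hs : Ready D L s)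
    (hcl : ∀ i < D.n, D.cl i < L) (hd : ∀ j < L, s.nat 7 j = D.digit x j) :
    Achieves weightProgram s (100 * (D.n + 1)) fun s' =>
      s'.real 6 0 = D.weight x ∧ s'.nat 16 0 = D.card x := by
  refine (Achieves.seq_agree (T := 10) (U := 60 * D.n + 20)
    (post' := fun s' => s'.real 6 0 = 0 ∧ s'.nat 16 0 = 0)
    (Achieves.straight rfl (by decide) (by simp [Program.exec, RealExpr.eval, NatExpr.eval]))
    ?_).mono (by omega) fun _ h => h
  intro s₀ ⟨f0, f1⟩ hA₀
  have hs₀ := hs.of_agree hA₀ (by decide) (by decide)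
  refine (Achieves.forLoop (a := 10) (N := .numProducts) (n := D.n) (T := 45)
    (fun m s' =>
      (s'.real 6 0 = ∑ i ∈ Finset.range m, if D.rk i < D.digit x (D.cl i) then D.w i else 0) ∧
      s'.nat 16 0 = ∑ i ∈ Finset.range m, if D.rk i < D.digit x (D.cl i) then 1 else 0) (by decide)
    (fun s' hA => by simp [NatExpr.eval, hA.1 0 (by decide), hs₀.n])
    (by simp [f0, f1]) ?_).mono ?_ fun _ h => h
  · intro i s₁ hi hA hc ⟨h1, h2⟩
    have hs₁ := hs₀.of_agree hA (by decide) (by decide)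
    have hd' : s₁.nat 7 (D.cl i) = D.digit x (D.cl i) := by
      rw [hA.1 7 (by decide), hA₀.1 7 (by decide), hd _ (hcl i hi)]
    refine Achieves.straight rfl (by decide) ?_
    simp only [Program.exec, Test.Holds, NatExpr.eval, RealExpr.eval, hc, hs₁.cl, hs₁.rk, hs₁.w,
      hd', h1, not_le, Finset.sum_range_succ]
    split_ifs with h
    · simp [h2]
    · simp [h1, h2]
  · simp only [NatExpr.cost]; omega

/-- Compute the proportion of the customers who go beyond the current state. In the state without
used products the address of the price is meaningless, but then the first part of the test fails.
-/
def activeProgram : Program :=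
  .seq (.seq (.setR 7 (.ofNat (.const 0))) (.setN 17 (.var 16)))
    (.forLoop 18 .numCustomers
      (.seq
        (.cond (.and (.natLE (.const 1) (.var 16))
            (.realLE (.get 3 (.sub (.var 17) (.const 1))) (.var 6)))
          .skip (.setR 7 (.add (.var 7) (.get 2 (.var 18)))))
        (.setN 17 (.add (.var 17) .numProducts))))

theorem activeProgram_spec {D : Tables} {L x : ℕ} {s : Memory} (hs : Ready D L s)
    (hW : s.real 6 0 = D.weight x) (hp : s.nat 16 0 = D.card x) :
    Achieves activeProgram s (100 * (D.K + 1)) fun s' => s'.real 7 0 = D.active x := by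
  classical
  refine (Achieves.seq_agree (T := 15) (U := 60 * D.K + 20)
    (post' := fun s' => s'.real 7 0 = 0 ∧ s'.nat 17 0 = D.card x)
    (Achieves.straight rfl (by decide) (by simp [Program.exec, RealExpr.eval, NatExpr.eval, hp]))
    ?_).mono (by omega) fun _ h => h
  intro s₀ ⟨f0, f1⟩ hA₀
  have hs₀ := hs.of_agree hA₀ (by decide) (by decide)
  refine (Achieves.forLoop (a := 18) (N := .numCustomers) (n := D.K) (T := 45)
    (fun m s' => (s'.real 7 0 = ∑ k ∈ Finset.range m,
        if 1 ≤ D.card x ∧ D.r (D.card x + k * D.n - 1) ≤ D.weight x then 0 else D.θ k) ∧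
      s'.nat 17 0 = D.card x + m * D.n) (by decide)
    (fun s' hA => by simp [NatExpr.eval, hA.1 0 (by decide), hs₀.K])
    (by simp [f0, f1]) ?_).mono ?_ fun _ h => h.1
  · intro k s₁ hk hA hc ⟨h1, h2⟩
    have hs₁ := hs₀.of_agree hA (by decide) (by decide)
    have hW' : s₁.real 6 0 = D.weight x := by rw [hA.2 6 (by decide), hA₀.2 6 (by decide), hW]
    have hp' : s₁.nat 16 0 = D.card x := by rw [hA.1 16 (by decide), hA₀.1 16 (by decide), hp]
    refine Achieves.straight rfl (by decide) ?_
    simp only [Program.exec, Test.Holds, NatExpr.eval, RealExpr.eval, hc, hs₁.r, hs₁.θ,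
      h1, h2, hW', hp', Finset.sum_range_succ]
    split_ifs with h
    · simp [h1, h2, hs₁.n]; ring
    · simp [h2, hs₁.n]; ring
  · simp only [NatExpr.cost]; omega

/-- Compute value and optimal choice of the current state. -/
def bellmanProgram : Program :=
  .seq (.seq (.assignReal 8 (.var 14) (.ofNat (.const 0))) (.assignNat 8 (.var 14) (.const 0)))
    (.forLoop 10 .numProducts
      (.cond (.and (.natLE (.get 3 (.var 10)) (.get 7 (.get 2 (.var 10))))
          (.natLE (.get 7 (.get 2 (.var 10))) (.get 3 (.var 10))))
        (.seq
          (.setR 5 (.add (.get 8 (.add (.var 14) (.get 4 (.get 2 (.var 10)))))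
            (.mul (.var 7)
              (.sub (.share (.add (.var 6) (.get 1 (.var 10)))) (.share (.var 6))))))
          (.cond (.realLE (.get 8 (.var 14)) (.var 5))
            (.seq (.assignReal 8 (.var 14) (.var 5)) (.assignNat 8 (.var 14) (.var 10))) .skip))
        .skip))

theorem bellmanProgram_spec {D : Tables} {L x : ℕ} {s : Memory} (hs : Ready D L s)
    (hw : ∀ i < D.n, 0 ≤ D.w i) (hθ : ∀ k < D.K, 0 ≤ D.θ k) (hV : ∀ y, 0 ≤ s.real 8 y)
    (hx : s.nat 14 0 = x)
    (hcl : ∀ i < D.n, D.cl i < L) (hd : ∀ j < L, s.nat 7 j = D.digit x j)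
    (hW : s.real 6 0 = D.weight x) (hΘ : s.real 7 0 = D.active x) :
    Achieves bellmanProgram s (200 * (D.n + 1)) fun s' =>
      D.Bellman (s'.real 8) (s'.nat 8) x ∧ (∀ y, 0 ≤ s'.real 8 y) ∧
      ∀ y, y ≠ x → s'.real 8 y = s.real 8 y ∧ s'.nat 8 y = s.nat 8 y := by
  refine (Achieves.seq_agree (T := 20) (U := 150 * D.n + 20)
    (post' := fun s' => s'.real 8 x = 0 ∧
      ∀ y, y ≠ x → s'.real 8 y = s.real 8 y ∧ s'.nat 8 y = s.nat 8 y)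
    (Achieves.straight rfl (by decide) ?_)
    ?_).mono (by omega) fun _ h => h
  · simp only [Program.exec, RealExpr.eval, NatExpr.eval, hx, Memory.setNat_real,
      Memory.setReal_real, Memory.setReal_nat, Memory.setNat_nat, Function.update_self,
      Nat.cast_zero, true_and]
    intro y hy
    simp [hy]
  intro s₀ ⟨f0, f1⟩ hA₀
  have hs₀ := hs.of_agree hA₀ (by decide) (by decide)
  refine (Achieves.forLoop (a := 10) (N := .numProducts) (n := D.n) (T := 130)
    (fun m s' => 0 ≤ s'.real 8 x ∧
      (∀ y, y ≠ x → s'.real 8 y = s.real 8 y ∧ s'.nat 8 y = s.nat 8 y) ∧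
      (∀ i < m, D.Next x i → D.candidate (s.real 8) x i ≤ s'.real 8 x) ∧
      ((∃ i < m, D.Next x i) → s'.nat 8 x < D.n ∧ D.Next x (s'.nat 8 x) ∧
        s'.real 8 x = D.candidate (s.real 8) x (s'.nat 8 x)) ∧
      ((¬ ∃ i < m, D.Next x i) → s'.real 8 x = 0)) (by decide)
    (fun s' hA => by simp [NatExpr.eval, hA.1 0 (by decide), hs₀.n])
    (by simpa [f0] using f1) ?_).mono ?_ ?_
  · intro i s₁ hi hA hc ⟨h1, h2, h3, h4, h5⟩
    have hs₁ := hs₀.of_agree hA (by decide) (by decide)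
    have hW' : s₁.real 6 0 = D.weight x := by rw [hA.2 6 (by decide), hA₀.2 6 (by decide), hW]
    have hΘ' : s₁.real 7 0 = D.active x := by rw [hA.2 7 (by decide), hA₀.2 7 (by decide), hΘ]
    have hx' : s₁.nat 14 0 = x := by rw [hA.1 14 (by decide), hA₀.1 14 (by decide), hx]
    have hd' : s₁.nat 7 (D.cl i) = D.digit x (D.cl i) := by
      rw [hA.1 7 (by decide), hA₀.1 7 (by decide), hd _ (hcl i hi)]
    have hy : x + (D.n + 1) ^ D.cl i ≠ x := by
      have : 0 < (D.n + 1) ^ D.cl i := by positivity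
      omega
    have hcand : s₁.real 8 (x + (D.n + 1) ^ D.cl i) +
        D.active x * (share (D.weight x + D.w i) - share (D.weight x)) =
        D.candidate (s.real 8) x i := by
      rw [(h2 _ hy).1, Tables.candidate]
    have hnn := D.candidate_nonneg hw hθ hV x hi
    refine Achieves.straight rfl (by decide) ?_
    have hnext : Test.Holds s₁ (.and (.natLE (.get 3 (.var 10)) (.get 7 (.get 2 (.var 10))))
        (.natLE (.get 7 (.get 2 (.var 10))) (.get 3 (.var 10)))) ↔ D.Next x i := by
      simp only [Test.Holds, NatExpr.eval, hc, hs₁.cl, hs₁.rk, hd', Tables.Next, le_antisymm_iff]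
    have keep : (D.Next x i → D.candidate (s.real 8) x i < s₁.real 8 x) →
        (∀ i' < i + 1, D.Next x i' → D.candidate (s.real 8) x i' ≤ s₁.real 8 x) ∧
        ((∃ i' < i + 1, D.Next x i') → s₁.nat 8 x < D.n ∧ D.Next x (s₁.nat 8 x) ∧
          s₁.real 8 x = D.candidate (s.real 8) x (s₁.nat 8 x)) ∧
        ((¬ ∃ i' < i + 1, D.Next x i') → s₁.real 8 x = 0) := by
      intro hlt
      refine ⟨fun i' hi' hN => ?_, fun hex => h4 ?_, fun hex => h5 ?_⟩
      · rcases Nat.lt_succ_iff_lt_or_eq.1 hi' with h' | rfl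
        · exact h3 i' h' hN
        · exact (hlt hN).le
      · -- A positive value at `x` shows that some product has been considered before.
        obtain ⟨i', hi', hN⟩ := hex
        rcases Nat.lt_succ_iff_lt_or_eq.1 hi' with h' | rfl
        · exact ⟨i', h', hN⟩
        · by_contra hno
          exact absurd (h5 hno) (hnn.trans_lt (hlt hN)).ne'
      · rintro ⟨i', hi', hN⟩
        exact hex ⟨i', by omega, hN⟩
    by_cases hN : D.Next x i
    · rw [Program.exec, if_pos (hnext.2 hN)]
      simp only [Program.exec, Test.Holds, RealExpr.share_eval, NatExpr.eval, RealExpr.eval, hc,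
        hs₁.cl, hs₁.w, hs₁.pow _ (hcl i hi).le, hx', hW', hΘ', hcand,
        Memory.setReal_nat, Memory.setReal_real, Function.update_self]
      simp only [ne_eq, Nat.reduceEqDiff, not_false_eq_true, Function.update_of_ne]
      split_ifs with hle
      · simp only [Memory.setNat_nat, Memory.setNat_real, ne_eq, Nat.reduceEqDiff,
          not_false_eq_true, Function.update_of_ne, Memory.setReal_nat, Memory.setReal_real,
          Function.update_self]
        refine ⟨hnn, fun y hy => ?_, fun i' hi' hN' => ?_, fun _ => ⟨hi, hN, trivial⟩,
          fun hno => absurd ⟨i, by omega, hN⟩ hno⟩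
        · simpa [hy] using h2 y hy
        · rcases Nat.lt_succ_iff_lt_or_eq.1 hi' with h' | rfl
          · exact (h3 i' h' hN').trans hle
          · exact le_rfl
      · simp only [Memory.setNat_nat, Memory.setNat_real, ne_eq, Nat.reduceEqDiff,
          not_false_eq_true, Function.update_of_ne, Memory.setReal_nat, Memory.setReal_real]
        exact ⟨h1, h2, keep fun _ => not_le.1 hle⟩
    · rw [Program.exec, if_neg (mt hnext.1 hN)]
      simp only [Program.exec, Memory.setNat_nat, Memory.setNat_real, ne_eq, Nat.reduceEqDiff,
        not_false_eq_true, Function.update_of_ne]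
      exact ⟨h1, h2, keep fun h => absurd h hN⟩
  · simp only [NatExpr.cost]; omega
  · rintro s' ⟨h1, h2, h3, h4, h5⟩
    have hc := D.candidate_congr (V := s.real 8) (V' := s'.real 8) (x := x)
      fun y hy => (h2 y hy.ne').1
    refine ⟨?_, fun y => ?_, h2⟩
    · simp only [Tables.Bellman, hc]
      exact ⟨h3, h4, h5⟩
    · rcases eq_or_ne y x with rfl | hy
      · exact h1
      · rw [(h2 y hy).1]; exact hV y

/-! ### The states of the dynamic program -/

/-- Increasing the digit `c` in base `B` without a carry does not change the higher digits. -/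
theorem div_pow_add_pow {B x c j : ℕ} (hB : 0 < B) (h : x / B ^ c % B + 1 < B) (hcj : c < j) :
    (x + B ^ c) / B ^ j = x / B ^ j := by
  obtain ⟨d, rfl⟩ := Nat.exists_eq_add_of_lt hcj
  rw [add_assoc, pow_add, pow_succ', ← Nat.div_div_eq_div_mul, ← Nat.div_div_eq_div_mul,
    ← Nat.div_div_eq_div_mul, ← Nat.div_div_eq_div_mul, Nat.add_div_right _ (by positivity)]
  congr 1
  have h1 := Nat.div_add_mod (x / B ^ c) B
  generalize x / B ^ c = y at *
  generalize y % B = r at *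
  nth_rewrite 1 [← h1]
  rw [add_assoc, Nat.mul_add_div hB, Nat.div_eq_of_lt h, add_zero]

theorem Precedes.trans {w : ℕ → ℝ} {i j k : ℕ} (h : Precedes w i j)
    (h' : Precedes w j k) : Precedes w i k := by
  refine ⟨h.1.trans h'.1, fun ⟨h1, h2⟩ => h.2 ⟨h'.1.trans h1, ?_⟩⟩
  by_contra hlt
  exact h'.2 ⟨h1.trans h.1, by omega⟩

theorem Precedes.irrefl {w : ℕ → ℝ} {i : ℕ} : ¬ Precedes w i i :=
  fun h => h.2 ⟨le_rfl, le_rfl⟩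

theorem Precedes.total {w : ℕ → ℝ} {i j : ℕ} (h : i ≠ j) :
    Precedes w i j ∨ Precedes w j i := by
  rcases lt_trichotomy (w i) (w j) with h' | h' | h'
  · exact Or.inl ⟨h'.le, fun h => absurd h.1 (not_le.2 h')⟩
  · rcases lt_or_gt_of_ne h with h'' | h''
    · exact Or.inl ⟨h'.le, fun h => by omega⟩
    · exact Or.inr ⟨h'.ge, fun h => by omega⟩
  · exact Or.inr ⟨h'.le, fun h => absurd h.1 (not_le.2 h')⟩

namespace Tables

variable (D : Tables)

/-- The products used in state `x`. -/
def used (x : ℕ) : Finset ℕ := (Finset.range D.n).filter fun i => D.rk i < D.digit x (D.cl i)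

theorem mem_used {x i : ℕ} : i ∈ D.used x ↔ i < D.n ∧ D.rk i < D.digit x (D.cl i) := by
  simp [used]

theorem weight_eq (x : ℕ) : D.weight x = ∑ i ∈ D.used x, D.w i := by
  rw [used, Finset.sum_filter, weight]

theorem card_eq (x : ℕ) : D.card x = (D.used x).card := by
  rw [used, Finset.card_filter, card]

theorem used_zero : D.used 0 = ∅ := by
  ext i
  simp [mem_used, digit]

theorem used_subset (x : ℕ) : D.used x ⊆ Finset.range D.n := Finset.filter_subset _ _

/-- The tables are correct: the classes are numbered by numbers below `L`, and the ranks are the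
positions of the products in their classes. -/
structure Valid (L : ℕ) : Prop where
  cl_lt : ∀ i < D.n, D.cl i < L
  rk : ∀ i < D.n, D.rk i = rank D.n D.w D.cl i

variable {D}

namespace Valid

variable {L : ℕ}

theorem rk_lt (hD : D.Valid L) {i i' : ℕ} (hi : i < D.n) (hi' : i' < D.n)
    (hcl : D.cl i' = D.cl i) (h : Precedes D.w i' i) : D.rk i' < D.rk i := by
  classical
  rw [hD.rk i hi, hD.rk i' hi', rank, rank]
  refine Finset.card_lt_card (Finset.ssubset_iff_of_subset ?_ |>.2 ⟨i', ?_, ?_⟩)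
  · intro k hk
    simp only [Finset.mem_filter] at hk ⊢
    exact ⟨hk.1, hk.2.1.trans hcl, hk.2.2.trans h⟩
  · simpa using ⟨hi', hcl, h⟩
  · simp [Precedes.irrefl]

theorem precedes_of_rk_lt (hD : D.Valid L) {i i' : ℕ} (hi : i < D.n) (hi' : i' < D.n)
    (hcl : D.cl i' = D.cl i) (h : D.rk i' < D.rk i) : Precedes D.w i' i := by
  have hne : i' ≠ i := by rintro rfl; exact lt_irrefl _ h
  rcases Precedes.total (w := D.w) hne with h' | h'
  · exact h'
  · exact absurd (hD.rk_lt hi' hi hcl.symm h') h.le.not_gt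

theorem eq_of_rk_eq (hD : D.Valid L) {i i' : ℕ} (hi : i < D.n) (hi' : i' < D.n)
    (hcl : D.cl i' = D.cl i) (h : D.rk i' = D.rk i) : i' = i := by
  by_contra hne
  rcases Precedes.total (w := D.w) hne with h' | h'
  · exact (hD.rk_lt hi hi' hcl h').ne h
  · exact (hD.rk_lt hi' hi hcl.symm h').ne h.symm

theorem rk_lt_n (hD : D.Valid L) {i : ℕ} (hi : i < D.n) : D.rk i < D.n := by
  classical
  rw [hD.rk i hi, rank]
  calc _ < (Finset.range D.n).card := Finset.card_lt_card
        (Finset.filter_ssubset.2 ⟨i, by simpa using hi, by simp [Precedes.irrefl]⟩)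
    _ = D.n := Finset.card_range _

/-- As long as a class has unused products, there is a next product of this class. -/
theorem exists_next (hD : D.Valid L) {x i : ℕ} (hi : i < D.n) (hx : i ∉ D.used x) :
    ∃ i' < D.n, D.cl i' = D.cl i ∧ D.Next x i' := by
  classical
  set U := (Finset.range D.n).filter fun i' => D.cl i' = D.cl i ∧ i' ∉ D.used x with hU
  obtain ⟨m, hm, hmin⟩ := U.exists_min_image D.rk ⟨i, by simp [hU, hi, hx]⟩
  simp only [hU, Finset.mem_filter, Finset.mem_range] at hm hmin
  obtain ⟨hmn, hmc, hmu⟩ := hm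
  refine ⟨m, hmn, hmc, le_antisymm ?_ ?_⟩
  · -- The predecessors of `m` in its class are used, and their ranks are different digits.
    rw [hD.rk m hmn, rank, ← Finset.card_range (D.digit x (D.cl m))]
    refine Finset.card_le_card_of_injOn D.rk ?_ ?_
    · intro k hk
      simp only [Finset.coe_filter, Finset.mem_range, Set.mem_ofPred_eq] at hk
      have hku : k ∈ D.used x := by
        by_contra hku
        exact absurd (hD.rk_lt hmn hk.1 hk.2.1 hk.2.2)
          (hmin k ⟨hk.1, hk.2.1.trans hmc, hku⟩).not_gt
      simpa [hk.2.1] using (D.mem_used.1 hku).2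
    · intro k hk k' hk' h
      simp only [Finset.coe_filter, Finset.mem_range, Set.mem_ofPred_eq] at hk hk'
      exact hD.eq_of_rk_eq hk'.1 hk.1 (hk.2.1.trans hk'.2.1.symm) h
  · by_contra hlt
    exact hmu (D.mem_used.2 ⟨hmn, not_le.1 hlt⟩)

theorem next_notMem {x i : ℕ} (h : D.Next x i) : i ∉ D.used x :=
  fun hu => (D.mem_used.1 hu).2.ne h

theorem digit_step (hD : D.Valid L) {x i : ℕ} (hi : i < D.n) (h : D.Next x i) (j : ℕ) :
    D.digit (x + (D.n + 1) ^ D.cl i) j = D.digit x j + if j = D.cl i then 1 else 0 := by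
  have hlt : D.digit x (D.cl i) + 1 < D.n + 1 := by
    rw [← h]; have := hD.rk_lt_n hi; omega
  rcases lt_trichotomy j (D.cl i) with h' | rfl | h'
  · obtain ⟨d, hd⟩ := Nat.exists_eq_add_of_lt h'
    rw [if_neg h'.ne, hd, digit, digit, add_assoc, pow_add,
      Nat.add_mul_div_left _ _ (by positivity), pow_succ', Nat.add_mul_mod_self_left, add_zero]
  · rw [if_pos rfl, digit, Nat.add_div_right _ (by positivity), Nat.add_mod,
      ← digit, Nat.mod_eq_of_lt (a := 1) (by omega), Nat.mod_eq_of_lt hlt]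
  · rw [if_neg h'.ne', digit, digit, div_pow_add_pow (Nat.succ_pos _) hlt h', add_zero]

theorem used_step (hD : D.Valid L) {x i : ℕ} (hi : i < D.n) (h : D.Next x i) :
    D.used (x + (D.n + 1) ^ D.cl i) = insert i (D.used x) := by
  ext k
  rw [Finset.mem_insert, mem_used, mem_used, hD.digit_step hi h]
  constructor
  · rintro ⟨hk, hlt⟩
    by_cases hku : D.rk k < D.digit x (D.cl k)
    · exact Or.inr ⟨hk, hku⟩
    · left
      split_ifs at hlt with hc
      · refine hD.eq_of_rk_eq hi hk hc ?_
        rw [h, ← hc]; omega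
      · omega
  · rintro (rfl | ⟨hk, hlt⟩)
    · refine ⟨hi, ?_⟩
      rw [if_pos rfl, h]; omega
    · exact ⟨hk, by omega⟩

theorem step_lt (hD : D.Valid L) {x i : ℕ} (hi : i < D.n) (h : D.Next x i)
    (hx : x < (D.n + 1) ^ L) : x + (D.n + 1) ^ D.cl i < (D.n + 1) ^ L := by
  have hlt : D.digit x (D.cl i) + 1 < D.n + 1 := by
    rw [← h]; have := hD.rk_lt_n hi; omega
  have := div_pow_add_pow (Nat.succ_pos _) hlt (hD.cl_lt i hi)
  rw [Nat.div_eq_of_lt hx, Nat.div_eq_zero_iff_lt (by positivity)] at this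
  exact this

theorem weight_step (hD : D.Valid L) {x i : ℕ} (hi : i < D.n) (h : D.Next x i) :
    D.weight (x + (D.n + 1) ^ D.cl i) = D.weight x + D.w i := by
  rw [weight_eq, weight_eq, hD.used_step hi h, Finset.sum_insert (next_notMem h), add_comm]

theorem card_step (hD : D.Valid L) {x i : ℕ} (hi : i < D.n) (h : D.Next x i) :
    (D.used (x + (D.n + 1) ^ D.cl i)).card = (D.used x).card + 1 := by
  rw [hD.used_step hi h, Finset.card_insert_of_notMem (next_notMem h)]

end Valid

/-- The state after `p` steps along the choices `arg`. -/
def path (D : Tables) (arg : ℕ → ℕ) : ℕ → ℕ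
  | 0 => 0
  | p + 1 => D.path arg p + (D.n + 1) ^ D.cl (arg (D.path arg p))

/-- The gain of the step from state `x` to state `y`. -/
noncomputable def gain (D : Tables) (x y : ℕ) : ℝ :=
  D.active x * (share (D.weight y) - share (D.weight x))

namespace Valid

variable {L : ℕ}

/-- The choices made along the optimal path are legal, and they realize the value of the initial
state. -/
theorem path_spec (hD : D.Valid L) {V : ℕ → ℝ} {arg : ℕ → ℕ}
    (hB : ∀ x < (D.n + 1) ^ L, D.Bellman V arg x) :
    ∀ p ≤ D.n, D.path arg p < (D.n + 1) ^ L ∧ (D.used (D.path arg p)).card = p ∧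
      (∀ q < p, arg (D.path arg q) < D.n ∧ D.Next (D.path arg q) (arg (D.path arg q))) ∧
      V 0 = (∑ q ∈ Finset.range p, D.gain (D.path arg q) (D.path arg (q + 1))) +
        V (D.path arg p) := by
  intro p
  induction p with
  | zero =>
    intro _
    refine ⟨by simp [path], by simp [path, used_zero], by simp, by simp [path]⟩
  | succ p ih =>
    intro hp
    obtain ⟨h1, h2, h3, h4⟩ := ih (by omega)
    have hex : ∃ i < D.n, D.Next (D.path arg p) i := by
      have hne : D.used (D.path arg p) ≠ Finset.range D.n := by
        intro h; rw [h, Finset.card_range] at h2; omega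
      obtain ⟨i, hi, hiu⟩ := Finset.exists_of_ssubset
        (Finset.ssubset_iff_subset_ne.2 ⟨D.used_subset _, hne⟩)
      obtain ⟨i', hi', -, hn⟩ := hD.exists_next (Finset.mem_range.1 hi) hiu
      exact ⟨i', hi', hn⟩
    obtain ⟨ha, hn, hv⟩ := (hB _ h1).2.1 hex
    refine ⟨hD.step_lt ha hn h1, by rw [path, hD.card_step ha hn, h2], fun q hq => ?_, ?_⟩
    · rcases Nat.lt_succ_iff_lt_or_eq.1 hq with h' | rfl
      exacts [h3 q h', ⟨ha, hn⟩]
    · rw [h4, Finset.sum_range_succ, hv, candidate, gain, path, hD.weight_step ha hn]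
      ring

/-- The value of the initial state is at least the total gain along any path. -/
theorem sum_gain_le (hD : D.Valid L) {V : ℕ → ℝ} {arg : ℕ → ℕ}
    (hB : ∀ x < (D.n + 1) ^ L, D.Bellman V arg x) (hV : ∀ x, 0 ≤ V x) {x c : ℕ → ℕ} {m : ℕ}
    (h0 : x 0 = 0) (hc : ∀ p < m, c p < D.n ∧ D.Next (x p) (c p) ∧
      x (p + 1) = x p + (D.n + 1) ^ D.cl (c p)) :
    ∑ q ∈ Finset.range m, D.gain (x q) (x (q + 1)) ≤ V 0 := by
  have key : ∀ p ≤ m, x p < (D.n + 1) ^ L ∧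
      (∑ q ∈ Finset.range p, D.gain (x q) (x (q + 1))) + V (x p) ≤ V 0 := by
    intro p
    induction p with
    | zero => intro _; simp [h0]
    | succ p ih =>
      intro hp
      obtain ⟨h1, h2⟩ := ih (by omega)
      obtain ⟨hi, hn, hx⟩ := hc p (by omega)
      refine ⟨hx ▸ hD.step_lt hi hn h1, le_trans ?_ h2⟩
      have := (hB _ h1).1 _ hi hn
      rw [candidate] at this
      rw [Finset.sum_range_succ, gain, hx, hD.weight_step hi hn]
      linarith
  linarith [(key m le_rfl).2, hV (x m)]

end Valid

end Tables

/-! ### The whole program -/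

/-- Process all states in decreasing order of their codes. -/
def stateProgram : Program :=
  .forLoop 13 (.get 4 (.var 12))
    (.seq (.setN 14 (.sub (.sub (.get 4 (.var 12)) (.const 1)) (.var 13)))
      (.seq digitProgram (.seq weightProgram (.seq activeProgram bellmanProgram))))

theorem stateProgram_spec {D : Tables} {L : ℕ} {s : Memory} (hs : Ready D L s)
    (hD : D.Valid L) (hw : ∀ i < D.n, 0 ≤ D.w i) (hθ : ∀ k < D.K, 0 ≤ D.θ k)
    (hV : ∀ y, 0 ≤ s.real 8 y) :
    Achieves stateProgram s ((D.n + 1) ^ L * (800 * (L + D.n + D.K + 1)) + 20) fun s' =>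
      (∀ x < (D.n + 1) ^ L, D.Bellman (s'.real 8) (s'.nat 8) x) ∧ ∀ y, 0 ≤ s'.real 8 y := by
  refine (Achieves.forLoop (a := 13) (N := .get 4 (.var 12)) (n := (D.n + 1) ^ L)
    (T := 600 * (L + D.n + D.K + 1) + 50)
    (fun z s' => (∀ x < (D.n + 1) ^ L, (D.n + 1) ^ L ≤ x + z →
      D.Bellman (s'.real 8) (s'.nat 8) x) ∧ ∀ y, 0 ≤ s'.real 8 y) (by decide)
    (fun s' hA => by
      simp [NatExpr.eval, hA.1 12 (by decide), hA.1 4 (by decide), hs.numClasses, hs.pow])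
    ⟨fun x hx hx' => by omega, hV⟩ ?_).mono ?_ fun s' h => ⟨fun x hx => h.1 x hx (by omega), h.2⟩
  · intro z s₁ hz hA hc ⟨h1, h2⟩
    have hs₁ := hs.of_agree hA (by decide) (by decide)
    obtain ⟨x, hx⟩ : ∃ x, x = (D.n + 1) ^ L - 1 - z := ⟨_, rfl⟩
    have hxN : x < (D.n + 1) ^ L := by omega
    refine (Achieves.seq_agree (T := 20) (U := 600 * (L + D.n + D.K + 1) + 30)
      (post' := fun s' => s'.nat 14 0 = x)
      (Achieves.straight rfl (by decide)
        (by simp [Program.exec, NatExpr.eval, hs₁.numClasses, hs₁.pow, hc, hx])) ?_).mono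
      (by omega) fun _ h => h
    intro s₂ hx₂ hA₂
    have hs₂ := hs₁.of_agree hA₂ (by decide) (by decide)
    refine (Achieves.seq_agree (digitProgram_spec hs₂ hx₂ hxN)
      (U := 500 * (L + D.n + D.K + 1)) ?_).mono (by omega) fun _ h => h
    intro s₃ hd₃ hA₃
    have hs₃ := hs₂.of_agree hA₃ (by decide) (by decide)
    refine (Achieves.seq_agree (weightProgram_spec hs₃ hD.cl_lt hd₃)
      (U := 200 * (D.n + 1) + 100 * (D.K + 1)) ?_).mono (by omega) fun _ h => h
    intro s₄ ⟨hW₄, hp₄⟩ hA₄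
    have hs₄ := hs₃.of_agree hA₄ (by decide) (by decide)
    refine (Achieves.seq_agree (activeProgram_spec hs₄ hW₄ hp₄)
      (U := 200 * (D.n + 1)) ?_).mono (by omega) fun _ h => h
    intro s₅ hΘ₅ hA₅
    have hs₅ := hs₄.of_agree hA₅ (by decide) (by decide)
    have e8 : s₅.real 8 = s₁.real 8 := by
      rw [hA₅.2 8 (by decide), hA₄.2 8 (by decide), hA₃.2 8 (by decide), hA₂.2 8 (by decide)]
    have n8 : s₅.nat 8 = s₁.nat 8 := by
      rw [hA₅.1 8 (by decide), hA₄.1 8 (by decide), hA₃.1 8 (by decide), hA₂.1 8 (by decide)]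
    refine (bellmanProgram_spec (x := x) hs₅ hw hθ (by rw [e8]; exact h2) ?_
      hD.cl_lt ?_ ?_ hΘ₅).mono
      (by omega) ?_
    · rw [hA₅.1 14 (by decide), hA₄.1 14 (by decide), hA₃.1 14 (by decide), hx₂]
    · intro j hj
      rw [hA₅.1 7 (by decide), hA₄.1 7 (by decide), hd₃ j hj]
    · rw [hA₅.2 6 (by decide), hW₄]
    · rintro s₆ ⟨g1, g2, g3⟩
      refine ⟨fun y hy hyz => ?_, g2⟩
      simp only [Memory.setNat_real, Memory.setNat_nat, ne_eq, Nat.reduceEqDiff,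
        not_false_eq_true, Function.update_of_ne]
      rcases eq_or_ne y x with rfl | hne
      · exact g1
      · refine (h1 y hy (by omega)).congr (fun y' hy' => ?_) ?_
        · rw [(g3 y' (by omega)).1, e8]
        · rw [(g3 y hne).2, n8]
  · have : (D.n + 1) ^ L * (600 * (L + D.n + D.K + 1) + 50 +
        (NatExpr.get 4 (.var 12)).cost + 11) ≤
        (D.n + 1) ^ L * (800 * (L + D.n + D.K + 1)) := by
      refine Nat.mul_le_mul_left _ ?_
      simp only [NatExpr.cost]; omega
    have h' : (NatExpr.get 4 (.var 12)).cost ≤ 12 := by decide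
    omega

/-- Follow the optimal choices from the initial state, and write the products to the output. -/
def outputProgram : Program :=
  .seq (.setN 14 (.const 0))
    (.forLoop 10 .numProducts
      (.seq (.assignNat 1 (.var 10) (.get 8 (.var 14)))
        (.setN 14 (.add (.var 14) (.get 4 (.get 2 (.get 8 (.var 14))))))))

theorem outputProgram_spec {D : Tables} {L : ℕ} {s : Memory} (hs : Ready D L s)
    (hcl : ∀ p < D.n, D.cl (s.nat 8 (D.path (s.nat 8) p)) ≤ L) :
    Achieves outputProgram s (100 * (D.n + 1)) fun s' =>
      ∀ p < D.n, s'.nat 1 p = s.nat 8 (D.path (s.nat 8) p) := by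
  refine (Achieves.seq_agree (T := 10) (U := 60 * D.n + 20)
    (post' := fun s' => s'.nat 14 0 = 0)
    (Achieves.straight rfl (by decide) (by simp [Program.exec, NatExpr.eval])) ?_).mono
    (by omega) fun _ h => h
  intro s₀ f0 hA₀
  have hs₀ := hs.of_agree hA₀ (by decide) (by decide)
  refine (Achieves.forLoop (a := 10) (N := .numProducts) (n := D.n) (T := 40)
    (fun m s' => s'.nat 14 0 = D.path (s.nat 8) m ∧
      ∀ p < m, s'.nat 1 p = s.nat 8 (D.path (s.nat 8) p)) (by decide)
    (fun s' hA => by simp [NatExpr.eval, hA.1 0 (by decide), hs₀.n])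
    (by simp [f0, Tables.path]) ?_).mono ?_ fun _ h => h.2
  · intro p s₁ hp hA hc ⟨h1, h2⟩
    have hs₁ := hs₀.of_agree hA (by decide) (by decide)
    have e8 : s₁.nat 8 = s.nat 8 := by rw [hA.1 8 (by decide), hA₀.1 8 (by decide)]
    refine Achieves.straight rfl (by decide) ⟨?_, fun q hq => ?_⟩
    · simp [Program.exec, NatExpr.eval, hc, h1, hs₁.cl, e8, hs₁.pow _ (hcl p hp), Tables.path]
    · rcases Nat.lt_succ_iff_lt_or_eq.1 hq with h' | rfl
      · simp [Program.exec, NatExpr.eval, hc, h'.ne, h2 q h']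
      · simp [Program.exec, NatExpr.eval, hc, h1, e8]
  · simp only [NatExpr.cost]; omega

/-- The approximation scheme for at least two products. -/
def schemeProgram : Program :=
  .seq thresholdProgram (.seq classProgram (.seq rankProgram (.seq powProgram
    (.seq divModProgram (.seq stateProgram outputProgram)))))

/-- What the approximation scheme computes, in terms of the tables `D`, the largest share `gm` of a
single product, the values `V` and the choices `arg`. -/
theorem schemeProgram_spec {s : Memory} {n K M : ℕ} {w θ r : ℕ → ℝ} {ε : ℝ} (hn : s.nat 0 0 = n)
    (hK : s.nat 0 1 = K) (hw : s.real 1 = w) (hθ : s.real 2 = θ) (hr : s.real 3 = r)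
    (hε : s.real 0 0 = ε) (hnat : ∀ a ≠ 0, ∀ i, s.nat a i = 0)
    (hreal : ∀ a, 3 < a → ∀ i, s.real a i = 0) (hn0 : (0 : ℝ) < n)
    (hw0 : ∀ i < n, 0 ≤ w i) (hθ0 : ∀ k < K, 0 ≤ θ k)
    (hM : 4 * n ≤ ε * (1 + ε / 2) ^ M) :
    Achieves schemeProgram s (4000 * ((n + 1) ^ (M + 1) * ((n + 1) * (n + 1) * (M + 1) * (K + 1))))
      fun s' => ∃ (D : Tables) (L : ℕ) (gm : ℝ) (V : ℕ → ℝ) (arg : ℕ → ℕ),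
        (D.n = n ∧ D.K = K ∧ D.w = w ∧ D.θ = θ ∧ D.r = r) ∧ D.Valid L ∧
        0 ≤ gm ∧ (∀ i < n, share (w i) ≤ gm) ∧ (gm = 0 ∨ ∃ i < n, gm = share (w i)) ∧
        IsClassification n (fun i => share (w i)) (ε * gm / (4 * n)) (1 + ε / 2) D.cl ∧
        (∀ x < (n + 1) ^ L, D.Bellman V arg x) ∧ (∀ x, 0 ≤ V x) ∧
        ∀ p < n, s'.nat 1 p = arg (D.path arg p) := by
  have hM' : ∀ gm : ℝ, 0 ≤ gm → gm ≤ ε * gm / (4 * n) * (1 + ε / 2) ^ M := by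
    intro gm hgm
    rw [div_mul_eq_mul_div, le_div_iff₀ (by positivity)]
    nlinarith
  have hB : ∀ {a b : ℕ}, a ≤ b → (n + 1) ^ a ≤ (n + 1) ^ b :=
    fun h => Nat.pow_le_pow_right (Nat.succ_pos _) h
  have hN0 : 1 ≤ (n + 1) ^ (M + 1) := Nat.one_le_pow _ _ (Nat.succ_pos _)
  -- `Y` is an upper bound for all numbers of iterations other than the number of states.
  obtain ⟨Y, hY⟩ : ∃ Y, Y = (n + 1) * (n + 1) * (M + 1) * (K + 1) := ⟨_, rfl⟩
  have hY1 : n + 1 ≤ Y := by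
    rw [hY, mul_assoc, mul_assoc]; exact Nat.le_mul_of_pos_right _ (by positivity)
  have hY2 : (n + 1) * (M + 1) ≤ Y := by
    rw [hY, show (n + 1) * (n + 1) * (M + 1) * (K + 1) =
      (n + 1) * (M + 1) * ((n + 1) * (K + 1)) by ring]
    exact Nat.le_mul_of_pos_right _ (by positivity)
  have hY3 : (n + 1) * (n + 1) ≤ Y := by
    rw [hY, mul_assoc]; exact Nat.le_mul_of_pos_right _ (by positivity)
  have hY4 : M + 1 ≤ Y := by
    rw [hY, mul_right_comm]; exact Nat.le_mul_of_pos_left _ (by positivity)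
  have hY5 : K + 1 ≤ Y := by
    rw [hY]; exact Nat.le_mul_of_pos_left _ (by positivity)
  have hX : Y ≤ (n + 1) ^ (M + 1) * Y := Nat.le_mul_of_pos_left _ (by omega)
  have hX' : (n + 1) ^ (M + 1) ≤ (n + 1) ^ (M + 1) * Y := Nat.le_mul_of_pos_right _ (by omega)
  rw [← hY]
  refine (Achieves.seq_agree (thresholdProgram_spec hn hw hε (hreal 4 (by omega) 0))
    (U := 3800 * ((n + 1) ^ (M + 1) * Y)) ?_).mono (by omega) fun _ h => h
  rintro s₁ ⟨gm, hg0, hg1, hg2, hτ⟩ hA₁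
  have n1 : s₁.nat 0 0 = n := by rw [hA₁.1 0 (by decide), hn]
  have w1 : s₁.real 1 = w := by rw [hA₁.2 1 (by decide), hw]
  refine (Achieves.seq_agree (classProgram_spec (M := M) n1 w1
    (by rw [hA₁.2 0 (by decide), hε]) hτ (by rw [hA₁.1 12 (by decide), hnat 12 (by omega)])
    fun i hi => (hg1 i hi).trans (hM' gm hg0))
    (U := 3600 * ((n + 1) ^ (M + 1) * Y)) ?_).mono (by rw [mul_assoc]; omega) fun _ h => h
  rintro s₂ ⟨hcl, hclL, hL⟩ hA₂
  have n2 : s₂.nat 0 0 = n := by rw [hA₂.1 0 (by decide), n1]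
  have w2 : s₂.real 1 = w := by rw [hA₂.2 1 (by decide), w1]
  refine (Achieves.seq_agree (rankProgram_spec n2 w2 rfl)
    (U := 3400 * ((n + 1) ^ (M + 1) * Y)) ?_).mono (by rw [mul_assoc]; omega) fun _ h => h
  intro s₃ hrk hA₃
  have n3 : s₃.nat 0 0 = n := by rw [hA₃.1 0 (by decide), n2]
  have w3 : s₃.real 1 = w := by rw [hA₃.2 1 (by decide), w2]
  obtain ⟨L, hL'⟩ : ∃ L, L = s₂.nat 12 0 := ⟨_, rfl⟩
  have l3 : s₃.nat 12 0 = L := by rw [hA₃.1 12 (by decide), hL']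
  have hpowcost : 200 * (n + 1) * (L + 1) ≤ 400 * ((n + 1) ^ (M + 1) * Y) := by
    have : (n + 1) * (L + 1) ≤ (n + 1) * (2 * (M + 1)) := Nat.mul_le_mul_left _ (by omega)
    have h2 : (n + 1) * (2 * (M + 1)) = 2 * ((n + 1) * (M + 1)) := by ring
    rw [mul_assoc]; omega
  refine (Achieves.seq_agree (powProgram_spec n3 l3)
    (U := 3000 * ((n + 1) ^ (M + 1) * Y)) ?_).mono (by omega) fun _ h => h
  intro s₄ hpow hA₄
  have n4 : s₄.nat 0 0 = n := by rw [hA₄.1 0 (by decide), n3]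
  have l4 : s₄.nat 12 0 = L := by rw [hA₄.1 12 (by decide), l3]
  have hNle : (n + 1) ^ L ≤ (n + 1) ^ (M + 1) := hB (by omega)
  refine (Achieves.seq_agree (divModProgram_spec n4 l4 (hpow L le_rfl)
    (by rw [hA₄.1 5 (by decide), hA₃.1 5 (by decide), hA₂.1 5 (by decide), hA₁.1 5 (by decide),
      hnat 5 (by omega)])
    (by rw [hA₄.1 6 (by decide), hA₃.1 6 (by decide), hA₂.1 6 (by decide), hA₁.1 6 (by decide),
      hnat 6 (by omega)]))
    (U := 2600 * ((n + 1) ^ (M + 1) * Y)) ?_).mono (by omega) fun _ h => h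
  intro s₅ hdiv hA₅
  obtain ⟨D, hD⟩ : ∃ D : Tables, D = ⟨n, K, w, θ, r, s₂.nat 2, s₃.nat 3⟩ := ⟨_, rfl⟩
  have hready : Ready D L s₅ := by
    subst hD
    constructor
    · exact (congrFun (hA₅.1 0 (by decide)) 0).trans n4
    · rw [hA₅.1 0 (by decide), hA₄.1 0 (by decide), hA₃.1 0 (by decide), hA₂.1 0 (by decide),
        hA₁.1 0 (by decide), hK]
    · rw [hA₅.2 1 (by decide), hA₄.2 1 (by decide), w3]
    · rw [hA₅.2 2 (by decide), hA₄.2 2 (by decide), hA₃.2 2 (by decide), hA₂.2 2 (by decide),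
        hA₁.2 2 (by decide), hθ]
    · rw [hA₅.2 3 (by decide), hA₄.2 3 (by decide), hA₃.2 3 (by decide), hA₂.2 3 (by decide),
        hA₁.2 3 (by decide), hr]
    · rw [hA₅.1 2 (by decide), hA₄.1 2 (by decide), hA₃.1 2 (by decide)]
    · rw [hA₅.1 3 (by decide), hA₄.1 3 (by decide)]
    · rw [hA₅.1 12 (by decide), l4]
    · rw [hA₅.1 4 (by decide)]; exact hpow
    · exact fun x hx => hdiv x hx.le
  have hvalid : D.Valid L := by
    subst hD
    exact ⟨fun i hi => hL' ▸ hclL i hi, hrk⟩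
  have e8 : s₅.real 8 = s.real 8 := by
    rw [hA₅.2 8 (by decide), hA₄.2 8 (by decide), hA₃.2 8 (by decide), hA₂.2 8 (by decide),
      hA₁.2 8 (by decide)]
  have hDn : D.n = n := by rw [hD]
  have hDK : D.K = K := by rw [hD]
  have hstatecost : (D.n + 1) ^ L * (800 * (L + D.n + D.K + 1)) + 20 ≤
      2420 * ((n + 1) ^ (M + 1) * Y) := by
    rw [hDn, hDK]
    have h1 : (n + 1) ^ L * (800 * (L + n + K + 1)) ≤ (n + 1) ^ (M + 1) * (2400 * Y) :=
      Nat.mul_le_mul hNle (by omega)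
    have h2 : (n + 1) ^ (M + 1) * (2400 * Y) = 2400 * ((n + 1) ^ (M + 1) * Y) := by ring
    calc _ ≤ 2400 * ((n + 1) ^ (M + 1) * Y) + 20 * ((n + 1) ^ (M + 1) * Y) :=
          Nat.add_le_add (h1.trans h2.le) (by omega)
      _ = _ := by ring
  refine (Achieves.seq_agree (stateProgram_spec hready hvalid (by subst hD; exact hw0)
    (by subst hD; exact hθ0) (fun y => by rw [e8, hreal 8 (by omega)]))
    (U := 100 * (n + 1)) ?_).mono ((Nat.add_le_add_right hstatecost _).trans (by omega))
    fun _ h => h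
  intro s₆ ⟨hbell, hV⟩ hA₆
  have hpath := (hvalid.path_spec hbell D.n le_rfl).2.2.1
  refine (outputProgram_spec (hready.of_agree hA₆ (by decide) (by decide))
    fun p hp => (hvalid.cl_lt _ (hpath p hp).1).le).mono (by rw [hDn]) fun s₇ hout => ?_
  refine ⟨D, L, gm, s₆.real 8, s₆.nat 8, by simp [hD], hvalid, hg0, hg1, hg2, ?_,
    by rw [← hDn]; exact hbell, hV, by rw [← hDn]; exact hout⟩
  rw [hD]
  exact hcl

/-- The approximation scheme. A single product needs no computation. -/
def rankingProgram : Program :=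
  .cond (.natLE .numProducts (.const 1)) .skip schemeProgram

/-! ### Rearranging the products within their classes -/

theorem share_nonneg {x : ℝ} (hx : 0 ≤ x) : 0 ≤ share x := div_nonneg hx (by linarith)

theorem share_lt_one {x : ℝ} (hx : 0 ≤ x) : share x < 1 := by
  rw [share, div_lt_one (by linarith)]; linarith

theorem share_add_le {x y : ℝ} (hx : 0 ≤ x) (hy : 0 ≤ y) : share (x + y) ≤ share x + y := by
  rw [share, share, div_add' _ _ _ (by linarith), div_le_div_iff₀ (by linarith) (by linarith)]
  nlinarith [mul_nonneg hx hy, mul_nonneg hy hy, mul_nonneg hx (mul_nonneg hy hy),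
    mul_nonneg hx (mul_nonneg hx hy)]

/-- The map `t ↦ t / (ρ + (ρ - 1) * t)` divides the share of a weight by `ρ`. It is concave and
therefore subadditive: if `y` is at least the sum of the images of the weights `u i`, then the share
of `y` is at least the share of the sum of the `u i`, divided by `ρ`. -/
theorem share_sum_le {ι : Type*} {S : Finset ι} {u : ι → ℝ} {y ρ : ℝ} (hu : ∀ i ∈ S, 0 ≤ u i)
    (hρ : 1 ≤ ρ) (hy : ∑ i ∈ S, u i / (ρ + (ρ - 1) * u i) ≤ y) :
    share (∑ i ∈ S, u i) ≤ ρ * share y := by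
  set U := ∑ i ∈ S, u i with hU
  have hU0 : 0 ≤ U := Finset.sum_nonneg hu
  have h1 : U / (ρ + (ρ - 1) * U) ≤ y := by
    refine le_trans ?_ hy
    rw [hU, Finset.sum_div]
    refine Finset.sum_le_sum fun i hi => ?_
    have hui := hu i hi
    have hle : u i ≤ U := Finset.single_le_sum hu hi
    have h0 : 0 ≤ (ρ - 1) * u i := mul_nonneg (by linarith) hui
    refine div_le_div_of_nonneg_left hui (by linarith) ?_
    have := mul_le_mul_of_nonneg_left hle (sub_nonneg.2 hρ)
    linarith
  have h0 : 0 ≤ (ρ - 1) * U := mul_nonneg (by linarith) hU0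
  have h2 := Tables.share_mono (div_nonneg hU0 (by linarith)) h1
  have h3 : share (U / (ρ + (ρ - 1) * U)) = share U / ρ := by
    have : ρ + (ρ - 1) * U ≠ 0 := by linarith
    have : 1 + U ≠ 0 := by linarith
    have : ρ ≠ 0 := by linarith
    have : ρ + (ρ - 1) * U + U ≠ 0 := by linarith
    rw [share, share, one_add_div ‹ρ + (ρ - 1) * U ≠ 0›, div_div_div_cancel_right₀ ‹_›, div_div]
    congr 1
    ring
  rw [h3, div_le_iff₀ (by linarith)] at h2
  linarith

theorem sum_image_range {a : ℕ → ℕ} {n p : ℕ} (hinj : Set.InjOn a (Finset.range n)) (hp : p ≤ n)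
    (φ : ℕ → ℝ) : ∑ i ∈ (Finset.range p).image a, φ i = ∑ q ∈ Finset.range p, φ (a q) :=
  Finset.sum_image (hinj.mono (by simpa using Set.Iio_subset_Iio hp))

theorem notMem_image_range {a : ℕ → ℕ} {n p : ℕ} (hinj : Set.InjOn a (Finset.range n))
    (hp : p < n) : a p ∉ (Finset.range p).image a := by
  intro h
  obtain ⟨q, hq, hqp⟩ := Finset.mem_image.1 h
  have hq' := Finset.mem_range.1 hq
  exact hq'.ne (hinj (by simp; omega) (by simpa using hp) hqp)

/-- The state reached when products of the classes of `a 0, …, a (p - 1)` are used. -/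
def Tables.follow (D : Tables) (a : ℕ → ℕ) (p : ℕ) : ℕ :=
  ∑ q ∈ Finset.range p, (D.n + 1) ^ D.cl (a q)

namespace Tables.Valid

variable {D : Tables} {L : ℕ}

/-- The used products of a state come first in their classes. Hence a sum over them is at most a sum
over any set with the same number of products in every class, if this holds for any two terms in the
order of a class. -/
theorem sum_used_le (hD : D.Valid L) {x : ℕ} {S : Finset ℕ} (hS : S ⊆ Finset.range D.n)
    (hcard : ∀ j, ((D.used x).filter fun i => D.cl i = j).card =
      (S.filter fun i => D.cl i = j).card)
    {φ ψ : ℕ → ℝ} (hle : ∀ i < D.n, ∀ i' < D.n, D.cl i = D.cl i' → D.w i ≤ D.w i' → φ i ≤ ψ i') :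
    ∑ i ∈ D.used x, φ i ≤ ∑ i ∈ S, ψ i := by
  rw [← Finset.sum_fiberwise_of_maps_to (t := Finset.range L) (g := D.cl) (s := D.used x)
      fun i hi => Finset.mem_range.2 (hD.cl_lt i (D.mem_used.1 hi).1),
    ← Finset.sum_fiberwise_of_maps_to (t := Finset.range L) (g := D.cl) (s := S)
      fun i hi => Finset.mem_range.2 (hD.cl_lt i (Finset.mem_range.1 (hS hi)))]
  refine Finset.sum_le_sum fun j _ => ?_
  set U := (D.used x).filter fun i => D.cl i = j with hU
  set T := S.filter fun i => D.cl i = j with hT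
  rw [← Finset.sum_inter_add_sum_sdiff U T, ← Finset.sum_inter_add_sum_sdiff T U,
    Finset.inter_comm T U]
  refine add_le_add (Finset.sum_le_sum fun i hi => ?_) ?_
  · have hi' : i < D.n := by
      simp only [hU, Finset.mem_inter, Finset.mem_filter] at hi
      exact (D.mem_used.1 hi.1.1).1
    exact hle i hi' i hi' rfl le_rfl
  · let e := Finset.equivOfCardEq (Finset.card_sdiff_comm (hcard j))
    rw [← Finset.sum_coe_sort (U \ T), ← Finset.sum_coe_sort (T \ U), ← Equiv.sum_comp e]
    refine Finset.sum_le_sum fun i _ => ?_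
    have h1 := i.2
    have h2 := (e i).2
    simp only [hU, hT, Finset.mem_sdiff, Finset.mem_filter, not_and] at h1 h2
    obtain ⟨⟨hiu, hic⟩, -⟩ := h1
    obtain ⟨⟨hes, hec⟩, heu⟩ := h2
    have hin := (D.mem_used.1 hiu).1
    have hen := Finset.mem_range.1 (hS hes)
    have heu' : (e i : ℕ) ∉ D.used x := fun h => heu h hec
    have hlt : D.rk i < D.rk (e i) := by
      by_contra hge
      refine heu' (D.mem_used.2 ⟨hen, ?_⟩)
      have := (D.mem_used.1 hiu).2
      rw [hic] at this
      rw [hec]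
      omega
    exact hle _ hin _ hen (hic.trans hec.symm)
      (hD.precedes_of_rk_lt hen hin (hic.trans hec.symm) hlt).1

theorem exists_next_follow (hD : D.Valid L) {a : ℕ → ℕ} (ha : ∀ q < D.n, a q < D.n)
    (hinj : Set.InjOn a (Finset.range D.n)) {p : ℕ} (hp : p < D.n)
    (hcard : ∀ j, ((D.used (D.follow a p)).filter fun i => D.cl i = j).card =
      (((Finset.range p).image a).filter fun i => D.cl i = j).card) :
    ∃ c < D.n, D.cl c = D.cl (a p) ∧ D.Next (D.follow a p) c := by
  have hnot := notMem_image_range hinj hp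
  suffices h : ∃ i < D.n, D.cl i = D.cl (a p) ∧ i ∉ D.used (D.follow a p) by
    obtain ⟨i, hi, hc, hu⟩ := h
    obtain ⟨c, hcn, hcc, hnext⟩ := hD.exists_next hi hu
    exact ⟨c, hcn, hcc.trans hc, hnext⟩
  by_contra! hall
  have h1 : insert (a p) (((Finset.range p).image a).filter fun i => D.cl i = D.cl (a p)) ⊆
      (D.used (D.follow a p)).filter fun i => D.cl i = D.cl (a p) := by
    intro i hi
    rw [Finset.mem_insert, Finset.mem_filter, Finset.mem_image] at hi
    rw [Finset.mem_filter]
    rcases hi with rfl | ⟨⟨q, hq, rfl⟩, hc⟩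
    · exact ⟨hall _ (ha p hp) rfl, rfl⟩
    · exact ⟨hall _ (ha q (by have := Finset.mem_range.1 hq; omega)) hc, hc⟩
  have h2 := Finset.card_le_card h1
  rw [hcard, Finset.card_insert_of_notMem (by simp [hnot])] at h2
  omega

theorem card_follow (hD : D.Valid L) {a : ℕ → ℕ} (ha : ∀ q < D.n, a q < D.n)
    (hinj : Set.InjOn a (Finset.range D.n)) : ∀ p ≤ D.n, ∀ j,
    ((D.used (D.follow a p)).filter fun i => D.cl i = j).card =
      (((Finset.range p).image a).filter fun i => D.cl i = j).card := by
  intro p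
  induction p with
  | zero => intro _ j; simp [follow, used_zero]
  | succ p ih =>
    intro hp j
    have ih' := ih (by omega)
    obtain ⟨c, hc, hcc, hnext⟩ := hD.exists_next_follow ha hinj (by omega) ih'
    have hnot := notMem_image_range hinj (Nat.lt_of_succ_le hp)
    have hstep : D.follow a (p + 1) = D.follow a p + (D.n + 1) ^ D.cl c := by
      rw [follow, Finset.sum_range_succ, hcc, follow]
    rw [hstep, hD.used_step hc hnext, Finset.range_add_one, Finset.image_insert,
      Finset.filter_insert, Finset.filter_insert, hcc]
    split_ifs with h
    · rw [Finset.card_insert_of_notMem (by simp [next_notMem hnext]),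
        Finset.card_insert_of_notMem (fun h => hnot (Finset.mem_filter.1 h).1), ih']
    · exact ih' j

/-- Using the products of every class in increasing order makes the weights smaller. -/
theorem weight_follow_le (hD : D.Valid L) {a : ℕ → ℕ} (ha : ∀ q < D.n, a q < D.n)
    (hinj : Set.InjOn a (Finset.range D.n)) {p : ℕ} (hp : p ≤ D.n) :
    D.weight (D.follow a p) ≤ ∑ q ∈ Finset.range p, D.w (a q) := by
  rw [weight_eq, ← sum_image_range hinj hp]
  refine hD.sum_used_le ?_ (hD.card_follow ha hinj p hp) fun i _ i' _ _ h => h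
  intro i hi
  obtain ⟨q, hq, rfl⟩ := Finset.mem_image.1 hi
  exact Finset.mem_range.2 (ha q (by have := Finset.mem_range.1 hq; omega))

/-- Using the products of every class in increasing order decreases the share only by a
factor `ρ` and by the contribution of the light products. -/
theorem share_le_follow (hD : D.Valid L) (hw : ∀ i < D.n, 0 ≤ D.w i) {τ ρ : ℝ} (hτ0 : 0 ≤ τ)
    (hτ : τ ≤ 1 / 2) (hρ : 1 ≤ ρ)
    (hcl : IsClassification D.n (fun i => share (D.w i)) τ ρ D.cl)
    {a : ℕ → ℕ} (ha : ∀ q < D.n, a q < D.n)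
    (hinj : Set.InjOn a (Finset.range D.n)) {p : ℕ} (hp : p ≤ D.n) :
    share (∑ q ∈ Finset.range p, D.w (a q)) ≤
      ρ * share (D.weight (D.follow a p)) + D.n * (2 * τ) := by
  classical
  have haw : ∀ q ∈ Finset.range p, 0 ≤ D.w (a q) := fun q hq =>
    hw _ (ha q (by have := Finset.mem_range.1 hq; omega))
  -- The weights of the heavy products.
  set u : ℕ → ℝ := fun i => if share (D.w i) ≤ τ then 0 else D.w i with hu
  have hu0 : ∀ i < D.n, 0 ≤ u i := fun i hi => by
    simp only [hu]; split_ifs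
    exacts [le_rfl, hw i hi]
  have hau : ∀ q ∈ Finset.range p, 0 ≤ u (a q) := fun q hq =>
    hu0 _ (ha q (by have := Finset.mem_range.1 hq; omega))
  have hlight : ∑ q ∈ Finset.range p, (D.w (a q) - u (a q)) ≤ D.n * (2 * τ) := by
    calc _ ≤ ∑ q ∈ Finset.range p, 2 * τ := by
          refine Finset.sum_le_sum fun q hq => ?_
          have h0 := haw q hq
          simp only [hu]
          split_ifs with h
          · rw [share, div_le_iff₀ (by linarith)] at h
            nlinarith
          · linarith
      _ = p * (2 * τ) := by simp
      _ ≤ D.n * (2 * τ) := by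
          have : (p : ℝ) ≤ D.n := by exact_mod_cast hp
          nlinarith
  have hlight0 : 0 ≤ ∑ q ∈ Finset.range p, (D.w (a q) - u (a q)) := by
    refine Finset.sum_nonneg fun q hq => ?_
    have h0 := haw q hq
    simp only [hu]
    split_ifs <;> linarith
  have hheavy : share (∑ q ∈ Finset.range p, u (a q)) ≤ ρ * share (D.weight (D.follow a p)) := by
    refine share_sum_le hau hρ ?_
    have := hD.sum_used_le (φ := fun i => -D.w i) (ψ := fun i => -(u i / (ρ + (ρ - 1) * u i)))
      (x := D.follow a p) (S := (Finset.range p).image a) ?_ (hD.card_follow ha hinj p hp) ?_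
    · rw [sum_image_range hinj hp, Finset.sum_neg_distrib, Finset.sum_neg_distrib,
        ← weight_eq] at this
      linarith
    · intro i hi
      obtain ⟨q, hq, rfl⟩ := Finset.mem_image.1 hi
      exact Finset.mem_range.2 (ha q (by have := Finset.mem_range.1 hq; omega))
    · intro i hi i' hi' hc hle
      have h0 := hw i hi
      have h0' := hw i' hi'
      rw [neg_le_neg_iff]
      by_cases hτi : share (D.w i') ≤ τ
      · simpa [hu, hτi] using h0
      · simp only [hu, if_neg hτi]
        have hc0 : D.cl i ≠ 0 := by
          intro h
          have := (hcl i' hi').1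
          rw [← hc, h, pow_zero, mul_one] at this
          exact hτi this
        obtain ⟨c, hcc⟩ := Nat.exists_eq_succ_of_ne_zero hc0
        have h1 := (hcl i' hi').1
        have h2 := (hcl i hi).2 c (by omega)
        rw [← hc, hcc, pow_succ, ← mul_assoc] at h1
        have h3 : share (D.w i') ≤ ρ * share (D.w i) := by nlinarith
        rw [share, share, ← mul_div_assoc, div_le_div_iff₀ (by linarith) (by linarith)] at h3
        have h4 : 0 ≤ (ρ - 1) * D.w i' := mul_nonneg (by linarith) h0'
        rw [div_le_iff₀ (by linarith)]
        nlinarith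
  have hsum : ∑ q ∈ Finset.range p, D.w (a q) = ∑ q ∈ Finset.range p, u (a q) +
      ∑ q ∈ Finset.range p, (D.w (a q) - u (a q)) := by
    rw [Finset.sum_sub_distrib]; ring
  rw [hsum]
  linarith [share_add_le (Finset.sum_nonneg hau) hlight0]

end Tables.Valid

end RealRAM

/-! ### The market share in terms of cumulative weights -/

namespace RankingInstance

open RealRAM

variable {n K : ℕ} (I : RankingInstance n K)

/-- The stopping point of customer `k` if `W m` is the total weight of the first `m` products. -/
noncomputable def stopAt (W : ℕ → ℝ) (k : Fin K) : ℕ :=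
  sInf ({m | ∃ p : Fin n, m = (p : ℕ) + 1 ∧ I.r k p ≤ W m} ∪ {n})

theorem stopAt_mem (W : ℕ → ℝ) (k : Fin K) :
    I.stopAt W k ∈ {m | ∃ p : Fin n, m = (p : ℕ) + 1 ∧ I.r k p ≤ W m} ∪ {n} :=
  Nat.sInf_mem ⟨n, Or.inr rfl⟩

theorem stopAt_le (W : ℕ → ℝ) (k : Fin K) : I.stopAt W k ≤ n := Nat.sInf_le (Or.inr rfl)

theorem stopAt_pos (hn : 0 < n) (W : ℕ → ℝ) (k : Fin K) : 1 ≤ I.stopAt W k := by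
  rcases I.stopAt_mem W k with ⟨p, hp, -⟩ | h
  · omega
  · rw [h]; exact hn

theorem stopAt_mono {W W' : ℕ → ℝ} (h : ∀ m ≤ n, W' m ≤ W m) (k : Fin K) :
    I.stopAt W k ≤ I.stopAt W' k := by
  refine Nat.sInf_le ?_
  rcases I.stopAt_mem W' k with ⟨p, hp, hr⟩ | h'
  · exact Or.inl ⟨p, hp, hr.trans (h _ (I.stopAt_le _ _))⟩
  · exact Or.inr h'

theorem stopAt_congr {W W' : ℕ → ℝ} (h : ∀ m ≤ n, W' m = W m) (k : Fin K) :
    I.stopAt W' k = I.stopAt W k :=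
  le_antisymm (I.stopAt_mono (fun m hm => (h m hm).ge) k)
    (I.stopAt_mono (fun m hm => (h m hm).le) k)

/-- Since the reservation prices decrease and the cumulative weights increase, a customer has
stopped before a given position exactly if her condition holds there. -/
theorem stopAt_le_iff {W : ℕ → ℝ} (hW : ∀ p q, p ≤ q → q ≤ n → W p ≤ W q) (k : Fin K) {p : ℕ}
    (hp : p < n) : I.stopAt W k ≤ p ↔ ∃ q : Fin n, p = (q : ℕ) + 1 ∧ I.r k q ≤ W p := by
  constructor
  · intro h
    rcases I.stopAt_mem W k with ⟨q, hq, hr⟩ | h'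
    · refine ⟨⟨p - 1, by omega⟩, by simp; omega, ?_⟩
      refine (I.r_antitone k ?_).trans (hr.trans (hW _ _ h hp.le))
      rw [Fin.le_def]; simp; omega
    · rw [h'] at h; omega
  · exact fun h => Nat.sInf_le (Or.inl h)

/-- The expected market share if `W m` is the total weight of the first `m` products. -/
noncomputable def shareOf (W : ℕ → ℝ) : ℝ := ∑ k, I.θ k * share (W (I.stopAt W k))

theorem marketShare_eq (A : Equiv.Perm (Fin n)) :
    I.marketShare A = I.shareOf fun m => I.weight (firstProducts A m) := rfl

theorem shareOf_congr {W W' : ℕ → ℝ} (h : ∀ m ≤ n, W' m = W m) : I.shareOf W' = I.shareOf W := by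
  rw [shareOf, shareOf]
  refine Finset.sum_congr rfl fun k _ => ?_
  rw [I.stopAt_congr h, h _ (I.stopAt_le _ _)]

/-- Smaller cumulative weights make the customers stop later, so that the loss of market share is
controlled by the loss at fixed positions. -/
theorem shareOf_le {W W' : ℕ → ℝ} {ρ δ : ℝ} (hρ : 0 ≤ ρ)
    (hW' : ∀ p q, p ≤ q → q ≤ n → W' p ≤ W' q) (h0 : ∀ m ≤ n, 0 ≤ W' m)
    (hle : ∀ m ≤ n, W' m ≤ W m) (hs : ∀ m ≤ n, share (W m) ≤ ρ * share (W' m) + δ) :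
    I.shareOf W ≤ ρ * I.shareOf W' + δ := by
  have h : ∀ k, I.θ k * share (W (I.stopAt W k)) ≤
      ρ * (I.θ k * share (W' (I.stopAt W' k))) + I.θ k * δ := by
    intro k
    have h1 := hs _ (I.stopAt_le W k)
    have h2 := Tables.share_mono (h0 _ (I.stopAt_le W k))
      (hW' _ _ (I.stopAt_mono hle k) (I.stopAt_le W' k))
    have h3 := mul_le_mul_of_nonneg_left
      (h1.trans (add_le_add_left (mul_le_mul_of_nonneg_left h2 hρ) δ)) (I.θ_nonneg k)
    linarith
  calc I.shareOf W ≤ ∑ k, (ρ * (I.θ k * share (W' (I.stopAt W' k))) + I.θ k * δ) :=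
        Finset.sum_le_sum fun k _ => h k
    _ = _ := by
        rw [Finset.sum_add_distrib, ← Finset.mul_sum, ← Finset.sum_mul, I.θ_sum, one_mul, shareOf]

/-- The market share is collected step by step: each step adds the increase of the share, for the
customers who have not stopped. -/
theorem shareOf_eq_sum {W : ℕ → ℝ} (h0 : W 0 = 0) :
    I.shareOf W = ∑ p ∈ Finset.range n,
      (∑ k, if p < I.stopAt W k then I.θ k else 0) * (share (W (p + 1)) - share (W p)) := by
  simp_rw [Finset.sum_mul]
  rw [Finset.sum_comm, shareOf]
  refine Finset.sum_congr rfl fun k _ => ?_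
  simp_rw [ite_mul, zero_mul]
  rw [← Finset.sum_filter]
  have : (Finset.range n).filter (fun p => p < I.stopAt W k) = Finset.range (I.stopAt W k) := by
    ext p
    have := I.stopAt_le W k
    simp; omega
  rw [this, ← Finset.mul_sum, Finset.sum_range_sub fun p => share (W p), h0]
  simp [share]

theorem weight_firstProducts (A : Equiv.Perm (Fin n)) {w : ℕ → ℝ} {a : ℕ → ℕ}
    (hw : ∀ i : Fin n, w i = I.w i) (ha : ∀ p : Fin n, a p = A p) {m : ℕ} (hm : m ≤ n) :
    I.weight (firstProducts A m) = ∑ q ∈ Finset.range m, w (a q) := by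
  rw [weight, firstProducts, Finset.sum_image A.injective.injOn, Finset.sum_filter]
  have : ∀ p : Fin n, (if (p : ℕ) < m then I.w (A p) else 0) =
      (fun q : ℕ => if q < m then w (a q) else 0) p := by
    intro p
    simp only [ha p, hw]
  rw [Finset.sum_congr rfl fun p _ => this p,
    Fin.sum_univ_eq_sum_range (fun q : ℕ => if q < m then w (a q) else 0), ← Finset.sum_filter]
  congr 1
  ext q
  simp; omega

theorem weight_nonneg (S : Finset (Fin n)) : 0 ≤ I.weight S :=
  Finset.sum_nonneg fun i _ => I.w_nonneg i

theorem weight_firstProducts_mono (A : Equiv.Perm (Fin n)) {m m' : ℕ} (h : m ≤ m') :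
    I.weight (firstProducts A m) ≤ I.weight (firstProducts A m') := by
  refine Finset.sum_le_sum_of_subset_of_nonneg (Finset.image_subset_image fun p hp => ?_)
    fun i _ _ => I.w_nonneg i
  simp only [Finset.mem_filter, Finset.mem_univ, true_and] at hp ⊢
  omega

theorem marketShare_le_opt (A : Equiv.Perm (Fin n)) : I.marketShare A ≤ I.opt :=
  Finset.le_sup' _ (Finset.mem_univ A)

/-- Every customer considers the first product. -/
theorem share_le_opt (i : Fin n) : share (I.w i) ≤ I.opt := by
  have hn : 0 < n := i.pos
  set A : Equiv.Perm (Fin n) := Equiv.swap ⟨0, hn⟩ i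
  refine le_trans ?_ (I.marketShare_le_opt A)
  rw [marketShare_eq, shareOf]
  calc share (I.w i) = ∑ k, I.θ k * share (I.w i) := by
        rw [← Finset.sum_mul, I.θ_sum, one_mul]
    _ ≤ _ := by
        refine Finset.sum_le_sum fun k _ => mul_le_mul_of_nonneg_left ?_ (I.θ_nonneg k)
        refine Tables.share_mono (I.w_nonneg i) ?_
        refine Finset.single_le_sum (f := I.w) (fun i _ => I.w_nonneg i) ?_
        refine Finset.mem_image.2 ⟨⟨0, hn⟩, ?_, Equiv.swap_apply_left _ _⟩
        simpa using Nat.lt_of_lt_of_le Nat.zero_lt_one (I.stopAt_pos hn _ k)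

theorem opt_nonneg : 0 ≤ I.opt :=
  le_trans (Finset.sum_nonneg fun k _ => mul_nonneg (I.θ_nonneg k)
    (share_nonneg (I.weight_nonneg _))) (I.marketShare_le_opt 1)

/-! ### Correctness of the dynamic program -/

/-- The tables `D` represent the instance `I`. Nothing is said about the entries beyond the ranges
of products and customers. -/
structure Represents (D : Tables) (I : RankingInstance n K) : Prop where
  numProducts : D.n = n
  numCustomers : D.K = K
  w : ∀ i : Fin n, D.w i = I.w i
  θ : ∀ k : Fin K, D.θ k = I.θ k
  r : ∀ (k : Fin K) (p : Fin n), D.r (k * n + p) = I.r k p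

variable {I} {D : Tables} {L : ℕ}

theorem Represents.w_nonneg (hI : Represents D I) (i : ℕ) (hi : i < D.n) : 0 ≤ D.w i := by
  have := hI.w ⟨i, hI.numProducts ▸ hi⟩
  rw [this]; exact I.w_nonneg _

theorem sum_gain_eq (hI : Represents D I) {x : ℕ → ℕ}
    (hcard : ∀ p ≤ n, (D.used (x p)).card = p)
    (hmono : ∀ p q, p ≤ q → q ≤ n → D.weight (x p) ≤ D.weight (x q)) :
    ∑ p ∈ Finset.range n, D.gain (x p) (x (p + 1)) = I.shareOf fun m => D.weight (x m) := by
  classical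
  have h0 : D.weight (x 0) = 0 := by
    rw [D.weight_eq, Finset.card_eq_zero.1 (hcard 0 (Nat.zero_le _)), Finset.sum_empty]
  rw [I.shareOf_eq_sum h0]
  refine Finset.sum_congr rfl fun p hp => ?_
  have hp := Finset.mem_range.1 hp
  rw [Tables.gain, Tables.active, Finset.sum_range, D.card_eq, hcard p hp.le]
  congr 1
  obtain ⟨rfl, rfl⟩ : D.n = n ∧ D.K = K := ⟨hI.numProducts, hI.numCustomers⟩
  refine Finset.sum_congr rfl fun k _ => ?_
  have hiff : (1 ≤ p ∧ D.r (p + k * D.n - 1) ≤ D.weight (x p)) ↔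
      ¬ p < I.stopAt (fun m => D.weight (x m)) k := by
    rw [not_lt, I.stopAt_le_iff hmono k hp]
    constructor
    · rintro ⟨h1, h2⟩
      refine ⟨⟨p - 1, by omega⟩, by simp; omega, ?_⟩
      rw [← hI.r]
      have : (k : ℕ) * D.n + (p - 1) = p + k * D.n - 1 := by omega
      simpa [this] using h2
    · rintro ⟨q, hq, hr⟩
      refine ⟨by omega, ?_⟩
      rw [← hI.r] at hr
      have : p + k * D.n - 1 = (k : ℕ) * D.n + q := by omega
      simpa [this] using hr
  rw [hI.θ k]
  by_cases h : p < I.stopAt (fun m => D.weight (x m)) k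
  · rw [if_neg (by rw [hiff]; simpa using h), if_pos h]
  · rw [if_pos (hiff.2 h), if_neg h]

/-- The value of the initial state is the market share of the assignment obtained by following the
optimal choices. -/
theorem exists_perm (hI : Represents D I) (hD : D.Valid L) {V : ℕ → ℝ} {arg : ℕ → ℕ}
    (hB : ∀ x < (D.n + 1) ^ L, D.Bellman V arg x) :
    ∃ A : Equiv.Perm (Fin n), (∀ p : Fin n, (A p : ℕ) = arg (D.path arg p)) ∧
      I.marketShare A = V 0 := by
  have hpath := hD.path_spec hB
  have hch := (hpath D.n le_rfl).2.2.1
  have hused : ∀ p ≤ D.n, ∀ q < p, arg (D.path arg q) ∈ D.used (D.path arg p) := by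
    intro p
    induction p with
    | zero => intro _ q hq; omega
    | succ p ih =>
      intro hp q hq
      obtain ⟨h1, h2⟩ := hch p (by omega)
      rw [Tables.path, hD.used_step h1 h2, Finset.mem_insert]
      rcases Nat.lt_succ_iff_lt_or_eq.1 hq with h' | rfl
      exacts [Or.inr (ih (by omega) q h'), Or.inl rfl]
  have hne : ∀ p < D.n, ∀ q < p, arg (D.path arg q) ≠ arg (D.path arg p) := by
    intro p hp q hq h
    exact Tables.Valid.next_notMem (hch p hp).2 (h ▸ hused p hp.le q hq)
  have hlt : ∀ p : Fin n, arg (D.path arg p) < n := fun p =>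
    (hch p (p.2.trans_eq hI.numProducts.symm)).1.trans_eq hI.numProducts
  let a : Fin n → Fin n := fun p => ⟨arg (D.path arg p), hlt p⟩
  have ha : Function.Injective a := by
    intro p q h
    have h' : arg (D.path arg p) = arg (D.path arg q) := congrArg Fin.val h
    have hp : (p : ℕ) < D.n := by rw [hI.numProducts]; exact p.2
    have hq : (q : ℕ) < D.n := by rw [hI.numProducts]; exact q.2
    rcases lt_trichotomy (p : ℕ) q with h1 | h1 | h1
    · exact absurd h' (hne q hq p h1)
    · exact Fin.ext h1
    · exact absurd h'.symm (hne p hp q h1)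
  let A : Equiv.Perm (Fin n) := Equiv.ofBijective a (Finite.injective_iff_bijective.1 ha)
  refine ⟨A, fun p => rfl, ?_⟩
  have hweight : ∀ m ≤ n, I.weight (firstProducts A m) = D.weight (D.path arg m) := by
    intro m hm
    rw [I.weight_firstProducts A (w := D.w) (a := fun q => arg (D.path arg q)) hI.w
      (fun p => rfl) hm]
    induction m with
    | zero => simp [Tables.path, Tables.weight_eq, Tables.used_zero]
    | succ m ih =>
      obtain ⟨h1, h2⟩ := hch m (by rw [hI.numProducts]; omega)
      rw [Finset.sum_range_succ, ih (by omega), Tables.path, hD.weight_step h1 h2]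
  have hV := (hpath D.n le_rfl).2.2.2
  have hend : V (D.path arg D.n) = 0 := by
    obtain ⟨h1, h2, -, -⟩ := hpath D.n le_rfl
    refine (hB _ h1).2.2 ?_
    rintro ⟨i, hi, hnext⟩
    have : D.used (D.path arg D.n) = Finset.range D.n :=
      Finset.eq_of_subset_of_card_le (D.used_subset _) (by rw [h2, Finset.card_range])
    exact Tables.Valid.next_notMem hnext (this ▸ Finset.mem_range.2 hi)
  rw [I.marketShare_eq, ← I.shareOf_congr (fun m hm => (hweight m hm).symm),
    ← sum_gain_eq hI (x := D.path arg)
      (fun p hp => (hpath p (by rw [hI.numProducts]; exact hp)).2.1) ?_, hV, hend, add_zero,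
    hI.numProducts]
  intro p q hpq hq
  rw [← hweight p (hpq.trans hq), ← hweight q hq]
  exact I.weight_firstProducts_mono A hpq

/-- Up to the factor `ρ` and the contribution of the light products, no assignment has a larger
market share than the value of the initial state. -/
theorem marketShare_le (hI : Represents D I) (hD : D.Valid L) {V : ℕ → ℝ} {arg : ℕ → ℕ}
    (hB : ∀ x < (D.n + 1) ^ L, D.Bellman V arg x) (hV : ∀ x, 0 ≤ V x) {τ ρ : ℝ} (hτ0 : 0 ≤ τ)
    (hτ : τ ≤ 1 / 2) (hρ : 1 ≤ ρ)
    (hcl : IsClassification n (fun i => share (D.w i)) τ ρ D.cl) (A : Equiv.Perm (Fin n)) :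
    I.marketShare A ≤ ρ * V 0 + n * (2 * τ) := by
  let a : ℕ → ℕ := fun q => if h : q < n then A ⟨q, h⟩ else 0
  have haA : ∀ p : Fin n, a p = A p := fun p => by simp [a]
  have ha : ∀ q < D.n, a q < D.n := by
    intro q hq
    rw [hI.numProducts] at hq ⊢
    simp [a, hq]
  have hinj : Set.InjOn a (Finset.range D.n) := by
    intro p hp q hq h
    simp only [Finset.coe_range, Set.mem_Iio, hI.numProducts] at hp hq
    simpa [a, hp, hq, ← Fin.ext_iff] using h
  have hcard := hD.card_follow ha hinj
  have hstep : ∀ p < D.n, ∃ c < D.n, D.cl c = D.cl (a p) ∧ D.Next (D.follow a p) c :=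
    fun p hp => hD.exists_next_follow ha hinj hp (hcard p hp.le)
  choose! c hc hcc hnext using hstep
  have hfollow : ∀ p < D.n, D.follow a (p + 1) = D.follow a p + (D.n + 1) ^ D.cl (c p) := by
    intro p hp
    rw [Tables.follow, Finset.sum_range_succ, hcc p hp, Tables.follow]
  have hzero : D.follow a 0 = 0 := by simp [Tables.follow]
  have hused : ∀ p ≤ n, (D.used (D.follow a p)).card = p := by
    intro p
    induction p with
    | zero => intro _; simp [hzero, Tables.used_zero]
    | succ p ih =>
      intro hp
      have hp' : p < D.n := by rw [hI.numProducts]; omega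
      rw [hfollow p hp', hD.card_step (hc p hp') (hnext p hp'), ih (by omega)]
  have hmono : ∀ p q, p ≤ q → q ≤ n → D.weight (D.follow a p) ≤ D.weight (D.follow a q) := by
    intro p q hpq
    induction q, hpq using Nat.le_induction with
    | base => exact fun _ => le_rfl
    | succ q hpq ih =>
      intro hq
      have hq' : q < D.n := by rw [hI.numProducts]; omega
      refine (ih (by omega)).trans ?_
      rw [hfollow q hq', hD.weight_step (hc q hq') (hnext q hq')]
      linarith [hI.w_nonneg _ (hc q hq')]
  have hgain := hD.sum_gain_le hB hV (x := D.follow a) (c := c) (m := n) hzero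
    fun p hp => by
      rw [← hI.numProducts] at hp
      exact ⟨hc p hp, hnext p hp, hfollow p hp⟩
  rw [sum_gain_eq hI hused hmono] at hgain
  rw [I.marketShare_eq]
  refine (I.shareOf_le (W' := fun m => D.weight (D.follow a m)) (ρ := ρ) (δ := n * (2 * τ))
    (by linarith) hmono (fun m _ => D.weight_nonneg hI.w_nonneg _) (fun m hm => ?_)
    fun m hm => ?_).trans ?_
  · rw [I.weight_firstProducts A hI.w haA hm]
    exact hD.weight_follow_le ha hinj (by rw [hI.numProducts]; exact hm)
  · rw [I.weight_firstProducts A hI.w haA hm]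
    have := hD.share_le_follow hI.w_nonneg hτ0 hτ hρ (by rw [hI.numProducts]; exact hcl) ha hinj
      (p := m) (by rw [hI.numProducts]; exact hm)
    rwa [hI.numProducts] at this
  · have := mul_le_mul_of_nonneg_left hgain (by linarith : 0 ≤ ρ)
    linarith

end RankingInstance

namespace RankingInstance

open RealRAM

variable {n K : ℕ} (I : RankingInstance n K)

theorem numCustomers_pos (I : RankingInstance n K) : 0 < K := by
  rcases Nat.eq_zero_or_pos K with rfl | h
  · have := I.θ_sum
    simp at this
  · exact h

theorem input_price (ε : ℝ) (k : Fin K) (p : Fin n) :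
    (I.input ε).real 3 (k * n + p) = I.r k p := by
  have e : (k : ℕ) * n + p = (finProdFinEquiv (k, p) : ℕ) := by simp; ring
  have h : (k : ℕ) * n + p < K * n := e ▸ (finProdFinEquiv (k, p)).2
  have e' : (⟨(k : ℕ) * n + p, h⟩ : Fin (K * n)) = finProdFinEquiv (k, p) := Fin.ext e
  have h' := congrArg (fun q => I.r q.1 q.2) (finProdFinEquiv.symm_apply_apply (k, p))
  exact (dif_pos h).trans (by rw [e']; exact h')

/-! ### The running time -/

/-- The bound `M` on the number of classes makes the range of relevant shares exceed `4 * n / ε`,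
and it is `O((1 / ε) * log (n / ε))`. -/
theorem exists_numClasses {ε : ℝ} (hε : 0 < ε) (hε1 : ε < 1) {n : ℕ} (hn : 2 ≤ n) :
    ∃ M : ℕ, 4 * n ≤ ε * (1 + ε / 2) ^ M ∧
      (3 * M + 7 : ℝ) ≤ 10000 * ((1 / ε) * Real.log (n / ε)) := by
  have hn' : (2 : ℝ) ≤ n := by exact_mod_cast hn
  have hlog : ε / 4 ≤ Real.log (1 + ε / 2) := by
    refine le_trans ?_ (Real.one_sub_inv_le_log_of_pos (by linarith))
    rw [le_sub_iff_add_le, ← le_sub_iff_add_le', inv_le_iff_one_le_mul₀ (by linarith)]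
    nlinarith
  have hlog0 : 0 < Real.log (1 + ε / 2) := by linarith
  have hq : (2 : ℝ) ≤ n / ε := by
    rw [le_div_iff₀ hε]; nlinarith
  have hY : Real.log 2 ≤ Real.log (n / ε) := Real.log_le_log (by norm_num) hq
  have h2 := Real.log_two_gt_d9
  refine ⟨⌈Real.log (4 * n / ε) / Real.log (1 + ε / 2)⌉₊, ?_, ?_⟩
  · have h := Nat.le_ceil (Real.log (4 * n / ε) / Real.log (1 + ε / 2))
    rw [div_le_iff₀ hlog0, ← Real.log_pow, Real.log_le_log_iff (by positivity) (by positivity),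
      div_le_iff₀ hε] at h
    linarith
  · have h4 : Real.log (4 * n / ε) ≤ 3 * Real.log (n / ε) := by
      rw [mul_div_assoc, Real.log_mul (by norm_num) (by positivity),
        show (4 : ℝ) = 2 ^ 2 by norm_num, Real.log_pow]
      push_cast
      linarith
    have h0 : 0 ≤ Real.log (4 * n / ε) := by
      refine Real.log_nonneg ?_
      rw [mul_div_assoc]; linarith
    have h5 : Real.log (4 * n / ε) / Real.log (1 + ε / 2) ≤ 12 * ((1 / ε) * Real.log (n / ε)) := by
      calc _ ≤ 3 * Real.log (n / ε) / (ε / 4) :=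
            div_le_div₀ (by linarith) h4 (by linarith) hlog
        _ = _ := by field_simp; ring
    have h6 := Nat.ceil_lt_add_one (div_nonneg h0 hlog0.le)
    have h7 : Real.log 2 ≤ (1 / ε) * Real.log (n / ε) := by
      have : 1 ≤ 1 / ε := by rw [le_div_iff₀ hε]; linarith
      nlinarith
    linarith

theorem time_le {n K M : ℕ} (hn : 2 ≤ n) (hK : 1 ≤ K) :
    (n + 1) ^ (M + 1) * ((n + 1) * (n + 1) * (M + 1) * (K + 1)) ≤
      2 * (K ^ 2 * n ^ (3 * M + 7)) := by
  have h1 : n + 1 ≤ n ^ 2 := by nlinarith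
  have h2 : M + 1 ≤ n ^ (M + 1) := (Nat.lt_pow_self (by omega)).le
  have h3 : K + 1 ≤ 2 * K ^ 2 := by nlinarith
  calc _ ≤ (n ^ 2) ^ (M + 1) * (n ^ 2 * n ^ 2 * n ^ (M + 1) * (2 * K ^ 2)) := by gcongr
    _ = _ := by ring

/-- The entries of the output array are initially zero, which is the only assignment of a single
product. -/
theorem rankingProgram_of_single (I : RankingInstance 1 K) {ε : ℝ} (hε : 0 < ε) :
    ∃ (s : Memory) (A : Equiv.Perm (Fin 1)), Runs rankingProgram (I.input ε) s 6 ∧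
      s.Outputs A ∧ (1 - ε) * I.opt ≤ I.marketShare A := by
  refine ⟨_, 1, .cond_true _ ?_ (.skip _), fun p => ?_, ?_⟩
  · simp [Test.Holds, NatExpr.eval, input]
  · simp [input]
  · have : I.opt ≤ I.marketShare 1 :=
      Finset.sup'_le _ _ fun A _ => le_of_eq (by rw [Subsingleton.elim A 1])
    nlinarith [I.opt_nonneg]

/-- For at least two products, the program computes a nearly optimal assignment; the time is
bounded in terms of the bound `M` on the classes of the products. -/
theorem rankingProgram_correct {ε : ℝ} (hε : 0 < ε) (hε1 : ε < 1) (hn : 2 ≤ n) {M : ℕ}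
    (hM : 4 * n ≤ ε * (1 + ε / 2) ^ M) :
    Achieves rankingProgram (I.input ε)
      (5000 * ((n + 1) ^ (M + 1) * ((n + 1) * (n + 1) * (M + 1) * (K + 1))))
      fun s => ∃ A : Equiv.Perm (Fin n), s.Outputs A ∧ (1 - ε) * I.opt ≤ I.marketShare A := by
  have hn0 : (0 : ℝ) < n := by exact_mod_cast (by omega : 0 < n)
  have hw : ∀ i : Fin n, (I.input ε).real 1 i = I.w i := fun i => by simp [input]
  have hθ : ∀ k : Fin K, (I.input ε).real 2 k = I.θ k := fun k => by simp [input]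
  have hcond : ¬ Test.Holds (I.input ε) (.natLE .numProducts (.const 1)) := by
    simp [Test.Holds, NatExpr.eval, input]; omega
  refine (Achieves.cond_neg hcond (schemeProgram_spec (s := I.input ε) (n := n) (K := K) (M := M)
    (ε := ε)
    (by simp [input]) (by simp [input]) rfl rfl rfl (by simp [input])
    (fun a ha i => by simp [input, ha])
    (fun a ha i => by
      have h0 : a ≠ 0 := by omega
      have h1 : a ≠ 1 := by omega
      have h2 : a ≠ 2 := by omega
      simp [input, h0, h1, h2, ha.ne'])
    hn0 (fun i hi => (hw ⟨i, hi⟩).symm ▸ I.w_nonneg _)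
    (fun k hk => (hθ ⟨k, hk⟩).symm ▸ I.θ_nonneg _) hM)).mono ?_ ?_
  · have h1 : 1 ≤ (n + 1) ^ (M + 1) * ((n + 1) * (n + 1) * (M + 1) * (K + 1)) :=
      Nat.one_le_iff_ne_zero.2 (by positivity)
    simp only [Test.cost, NatExpr.cost]
    omega
  rintro s ⟨D, L, gm, V, arg, ⟨h1, h2, h3, h4, h5⟩, hD, hg0, hg1, hg2, hcl, hB, hV, hout⟩
  have hI : Represents D I := ⟨h1, h2, fun i => by rw [h3, hw], fun k => by rw [h4, hθ],
    fun k p => by rw [h5, I.input_price]⟩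
  rw [← h1] at hB
  obtain ⟨A, hA, hAV⟩ := exists_perm hI hD hB
  refine ⟨A, fun p => by rw [hout p p.2, hA], ?_⟩
  have hgm1 : gm ≤ 1 := by
    rcases hg2 with rfl | ⟨i, hi, rfl⟩
    · exact zero_le_one
    · exact (share_lt_one ((hw ⟨i, hi⟩).symm ▸ I.w_nonneg _)).le
  have hgm : gm ≤ I.opt := by
    rcases hg2 with rfl | ⟨i, hi, rfl⟩
    · exact I.opt_nonneg
    · exact (congrArg share (hw ⟨i, hi⟩)).le.trans (I.share_le_opt ⟨i, hi⟩)
  have hn1 : (1 : ℝ) ≤ n := by exact_mod_cast (by omega : 1 ≤ n)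
  have hopt : I.opt ≤ (1 + ε / 2) * V 0 + n * (2 * (ε * gm / (4 * n))) := by
    refine Finset.sup'_le _ _ fun A' _ => ?_
    refine marketShare_le hI hD hB hV (by positivity) ?_ (by linarith) (h3 ▸ hcl) A'
    rw [div_le_iff₀ (by positivity)]
    nlinarith
  have heq : (n : ℝ) * (2 * (ε * gm / (4 * n))) = ε / 2 * gm := by field_simp; ring
  rw [heq] at hopt
  rw [hAV]
  -- `(1 - ε / 2) * opt ≤ (1 + ε / 2) * V 0`, and `(1 - ε) * (1 + ε / 2) ≤ 1 - ε / 2`.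
  have h6 : (1 - ε / 2) * I.opt ≤ (1 + ε / 2) * V 0 := by nlinarith
  have h7 : (1 + ε / 2) * ((1 - ε) * I.opt) ≤ (1 + ε / 2) * V 0 := by
    refine le_trans ?_ h6
    nlinarith [mul_nonneg (mul_nonneg hε.le hε.le) I.opt_nonneg]
  exact le_of_mul_le_mul_left h7 (by linarith)

end RankingInstance

theorem theorem2 :
    ∃ (P : RealRAM.Program) (C : ℝ), 0 < C ∧
      ∀ (ε : ℝ), 0 < ε → ε < 1 →
      ∀ (n K : ℕ), 0 < n →
      ∀ (I : RankingInstance n K),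
      ∃ (s : RealRAM.Memory) (t : ℕ) (A : Equiv.Perm (Fin n)),
        RealRAM.Runs P (I.input ε) s t ∧
        s.Outputs A ∧
        (1 - ε) * I.opt ≤ I.marketShare A ∧
        (t : ℝ) ≤ C * ((K : ℝ) ^ 2 * (n : ℝ) ^ (C * ((1 / ε) * Real.log ((n : ℝ) / ε)))) := by
  refine ⟨RealRAM.rankingProgram, 10000, by norm_num, fun ε hε hε1 n K hn I => ?_⟩
  have hK : (1 : ℝ) ≤ K := by exact_mod_cast I.numCustomers_pos
  rcases Nat.lt_or_ge n 2 with h | h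
  · obtain rfl : n = 1 := by omega
    obtain ⟨s, A, hrun, hout, hA⟩ := RankingInstance.rankingProgram_of_single I hε
    refine ⟨s, 6, A, hrun, hout, hA, ?_⟩
    rw [Nat.cast_one, Real.one_rpow]
    push_cast
    nlinarith
  · obtain ⟨M, hM, hexp⟩ := RankingInstance.exists_numClasses hε hε1 h
    obtain ⟨s, t, hrun, ht, A, hout, hA⟩ := I.rankingProgram_correct hε hε1 h hM
    refine ⟨s, t, A, hrun, hout, hA, ?_⟩
    have ht' : t ≤ 10000 * (K ^ 2 * n ^ (3 * M + 7)) := by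
      have := RankingInstance.time_le (M := M) h I.numCustomers_pos
      omega
    have hn1 : (1 : ℝ) ≤ n := by exact_mod_cast hn
    calc (t : ℝ) ≤ 10000 * ((K : ℝ) ^ 2 * (n : ℝ) ^ (3 * M + 7)) := by exact_mod_cast ht'
      _ ≤ _ := by
        rw [← Real.rpow_natCast (n : ℝ) (3 * M + 7)]
        gcongr
        push_cast
        exact hexp
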